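/- **Language.** Terms and formulas are generated from variables $v_0,v_1,\dots$ and two constants $\mathcal T,\mathcal F$: if $a,b$ are terms, $A,B$ formulas, $v$ a variable and $X$ an expression, then $\{v\mid A\}$ and the name $\ulcorner X\urcorner$ are terms, and $ba$ (also written $a\in b$), ${\downarrow}AB$ (joint denial) and $\forall vA$ are formulas. The binders are $\forall$ and $\{\cdot\mid\cdot\}$; one may quantify into names. The other connectives and $\exists$ are defined classically from $\downarrow,\forall$. A *constant* is a closed term, a *sentence* a closed formula. $\mathcal TA$ abbreviates $\mathcal T\ulcorner A\urcorner$, i.e. $\ulcorner A\urcorner\in\mathcal T$, and $a=b$ abbreviates $\forall u(a\in u\to b\in u)$. Put $\emptyset=\{x\mid x\neq x\}$, $a'=\{x\mid x\in a\vee x=a\}$, $\{a,b\}=\{x\mid x=a\vee x=b\}$, $\langle a,b\rangle=\{\{a,a\},\{a,b\}\}$, and $$\omega=\{x\mid\forall y(\emptyset\in y\wedge\forall z(z\in y\to z'\in y)\to x\in y)\},\qquad r=\{x\mid x\notin x\},$$ $$t=\{x\mid x=r\wedge x\notin x\wedge\neg\mathcal T\,x\in x\},$$ $$t_\omega=\{u\mid\forall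 x(\langle\emptyset,t\rangle\in x\wedge\forall y\forall z(\langle y,z\rangle\in x\to\langle y',\{v\mid v\in z\}\rangle\in x)\to u\in x)\},$$ $$B(x):\quad \exists w(\langle w,x\rangle\in t_\omega)\to r\notin x .$$ **Semantics.** A set $S$ of sentences is *full* if ${\downarrow}AC\in S$ iff neither $A\in S$ nor $C\in S$, and $\forall vA\in S$ iff $A_v^b\in S$ for all constants $b$. Let $\mathcal{CD}$ be a collection of full sets, one of which contains no atomic sentence $a\in b$. Let $\Omega$ be an index set, and for $n\in\Omega$ and each ordinal $\alpha$ let $\models_n^\alpha$ be a full set (a *barter*; write $\models_n^\alpha A$ for $A\in{\models_n^\alpha}$) such that $n\mapsto{\models_n^0}$ is a surjection of $\Omega$ onto $\mathcal{CD}$ and, for all $\alpha>0$, all sentences $A$, all constants $a$ and all constants $\{v\mid C\}$, $$\models_n^\alpha\mathcal TA\iff\exists\gamma<\alpha\ \forall\delta\,(\gamma\le\delta<\alpha\Rightarrow\models_n^\delta A),\qquad \models_n^\alpha a\in\{v\mid C\}\iff\exists\gamma<\alpha\ \forall\delta\,(\gamma\le\delta<\alpha\Rightarrow\models_n^\delta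 C_v^a).$$ Write $\models^\alpha A$ if $\models_n^\alpha A$ for all $n\in\Omega$; $\mathrm{IN}^\alpha(A)$ if $\models^\beta\mathcal TA$ for all $\beta\ge\alpha$; and $\mathrm{IN}(A)$ if $\mathrm{IN}^\alpha(A)$ for some $\alpha$. The *closure ordinal* $\varpi$ is the least $\alpha$ such that for every sentence $A$: $\mathrm{IN}(A)$ implies $\mathrm{IN}^\alpha(A)$, and $\models^\alpha\mathcal TA$ implies $\mathrm{IN}(A)$. A sentence $A$ is a *maxim*, $\Vdash^MA$, if $\models_n^\varpi\mathcal TA$ for all $n$; it is a *thesis*, $\Vdash A$, if $\models_n^\varpi\neg\mathcal T\neg A$ for all $n$. **Theorem.** 1. The truth-theoretic Barcan schema is not a maxim: $\not\Vdash^M\forall x\mathcal TB(x)\to\mathcal T\forall xB(x)$. 2. This instance of the schema is a thesis, and so is its failure: $$\Vdash\forall x\mathcal TB(x)\to\mathcal T\forall xB(x)\qquad\text{and}\qquad\Vdash\forall x\mathcal TB(x)\wedge\neg\mathcal T\forall xB(x).$$ 3. ($\omega$-consistency.) For all $n$, all ordinals $\alpha$ and all sentences $\exists vA$: $\models_n^\alpha\exists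 vA$ iff $\models_n^\alpha A_v^b$ for some constant $b$. Moreover the maxims are $\omega$-consistent: there is no sentence $\exists vA$ such that $\Vdash^M\exists vA$ and $\Vdash^M\neg A_v^b$ for every constant $b$. 4. The schema that McGee's argument for $\omega$-inconsistency relies on fails as a maxim: for some formula $A(x)$ with at most $x$ free, $\not\Vdash^M\forall x(x\in\omega\to\mathcal TA(x))\to\mathcal T\forall x(x\in\omega\to A(x))$. -/

import Mathlib

namespace Libra

/-! ## The formal language -/

/-- The two kinds of expressions of the language: terms and formulas. -/
inductive Kind : Type
  | term
  | formula

/-- Expressions of the Polish formal language. There are countably many variables `v_0, v_1, …`,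
two primitive set constants `𝒯` and `ℱ`, set abstracts `ς v A`, names `# X` of
arbitrary expressions, appositions `b a` of terms, joint denial `↓ A B`, and `∀ v A`. -/
inductive Expr : Kind → Type
  | var : ℕ → Expr Kind.term
  | truth : Expr Kind.term
  | falsity : Expr Kind.term
  | abs : ℕ → Expr Kind.formula → Expr Kind.term
  | name : {k : Kind} → Expr k → Expr Kind.term
  | app : Expr Kind.term → Expr Kind.term → Expr Kind.formula
  | nor : Expr Kind.formula → Expr Kind.formula → Expr Kind.formula
  | all : ℕ → Expr Kind.formula → Expr Kind.formula

/-- Terms. -/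
abbrev Tm : Type := Expr Kind.term

/-- Formulas. -/
abbrev Fm : Type := Expr Kind.formula

/-- The free variables of an expression. The binders are `∀` and `ς`; the name former is not a
binder, so that one can quantify into names. -/
def Expr.fv : {k : Kind} → Expr k → Finset ℕ
  | _, .var n => {n}
  | _, .truth => ∅
  | _, .falsity => ∅
  | _, .abs v A => A.fv.erase v
  | _, .name X => X.fv
  | _, .app b a => b.fv ∪ a.fv
  | _, .nor A B => A.fv ∪ B.fv
  | _, .all v A => A.fv.erase v

/-- A constant is a closed term, and a sentence is a closed formula. -/
def Expr.Closed {k : Kind} (X : Expr k) : Prop := X.fv = ∅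

/-- `X.subst v a` replaces all free occurrences of the variable `v` in `X` by the term `a`. (It is
only used with closed `a`, which is always substitutable.) -/
def Expr.subst : {k : Kind} → Expr k → ℕ → Tm → Expr k
  | _, .var n, v, a => if n = v then a else .var n
  | _, .truth, _, _ => .truth
  | _, .falsity, _, _ => .falsity
  | _, .abs w A, v, a => if w = v then .abs w A else .abs w (A.subst v a)
  | _, .name X, v, a => .name (X.subst v a)
  | _, .app b c, v, a => .app (b.subst v a) (c.subst v a)
  | _, .nor A B, v, a => .nor (A.subst v a) (B.subst v a)
  | _, .all w A, v, a => if w = v then .all w A else .all w (A.subst v a)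

/-! ## Defined operators -/

/-- Negation. -/
def neg (A : Fm) : Fm := .nor A A

/-- Conjunction. -/
def conj (A B : Fm) : Fm := .nor (neg A) (neg B)

/-- Disjunction. -/
def disj (A B : Fm) : Fm := neg (.nor A B)

/-- The conditional. -/
def imp (A B : Fm) : Fm := disj (neg A) B

/-- The existential quantifier. -/
def ex (v : ℕ) (A : Fm) : Fm := neg (.all v (neg A))

/-- Membership `a ∈ b`, defined as the apposition `b a`. -/
def mem (a b : Tm) : Fm := .app b a

/-- `𝒯⌜A⌝`: the truth predicate applied to the name of `A`. -/
def tr (A : Fm) : Fm := mem (.name A) .truth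

/-! In the following abbreviations `v_6` and `v_7` serve as bound variables only, and `v_4` is bound
in `elems`; they are applied to terms in which these variables are not free. -/

/-- Identity as co-essentiality: `a = b` is `∀ u (a ∈ u → b ∈ u)`. -/
def eq (a b : Tm) : Fm := .all 6 (imp (mem a (.var 6)) (mem b (.var 6)))

/-- `∅ = {x | x ≠ x}`. -/
def empty : Tm := .abs 7 (neg (eq (.var 7) (.var 7)))

/-- The successor `a' = {x | x ∈ a ∨ x = a}`. -/
def succ (a : Tm) : Tm := .abs 7 (disj (mem (.var 7) a) (eq (.var 7) a))

/-- `{a, b} = {x | x = a ∨ x = b}`. -/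
def upair (a b : Tm) : Tm := .abs 7 (disj (eq (.var 7) a) (eq (.var 7) b))

/-- The Kuratowski pair `⟨a, b⟩ = {{a}, {a, b}}`, where `{a} = {a, a}`. -/
def opair (a b : Tm) : Tm := upair (upair a a) (upair a b)

/-- `{v | v ∈ z}`. -/
def elems (z : Tm) : Tm := .abs 4 (mem (.var 4) z)

/-- `ω = {x | ∀ y (∅ ∈ y ∧ ∀ z (z ∈ y → z' ∈ y) → x ∈ y)}`. -/
def omega : Tm :=
  .abs 0 (.all 1 (imp
    (conj (mem empty (.var 1))
      (.all 2 (imp (mem (.var 2) (.var 1)) (mem (succ (.var 2)) (.var 1)))))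
    (mem (.var 0) (.var 1))))

/-- Russell's set `r = {x | x ∉ x}`. -/
def russell : Tm := .abs 0 (neg (mem (.var 0) (.var 0)))

/-- `t = {x | x = r ∧ x ∉ x ∧ ¬ 𝒯⌜x ∈ x⌝}`. -/
def tSet : Tm :=
  .abs 0 (conj (eq (.var 0) russell)
    (conj (neg (mem (.var 0) (.var 0))) (neg (tr (mem (.var 0) (.var 0))))))

/-- `t_ω = {u | ∀ x (⟨∅, t⟩ ∈ x ∧ ∀ y ∀ z (⟨y, z⟩ ∈ x → ⟨y', {v | v ∈ z}⟩ ∈ x) → u ∈ x)}`. -/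
def tOmega : Tm :=
  .abs 3 (.all 0 (imp
    (conj (mem (opair empty tSet) (.var 0))
      (.all 1 (.all 2 (imp
        (mem (opair (.var 1) (.var 2)) (.var 0))
        (mem (opair (succ (.var 1)) (elems (.var 2))) (.var 0))))))
    (mem (.var 3) (.var 0))))

/-- The McGee-style formula `B(x)`: `∃ w (⟨w, x⟩ ∈ t_ω) → r ∉ x`, where `x` is `v_0`. -/
def mcGee : Fm :=
  imp (ex 5 (mem (opair (.var 5) (.var 0)) tOmega)) (neg (mem russell (.var 0)))

/-- The instance `∀ v 𝒯⌜A⌝ → 𝒯⌜∀ v A⌝` of the truth-theoretic Barcan schema. -/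
def barcan (v : ℕ) (A : Fm) : Fm := imp (.all v (tr A)) (tr (.all v A))

/-- The instance `∀ x (x ∈ ω → 𝒯⌜A⌝) → 𝒯⌜∀ x (x ∈ ω → A)⌝` (with `x` the variable `v_0`) of the
schema on which McGee's argument for `ω`-inconsistency relies. -/
def mcGeeSchema (A : Fm) : Fm :=
  imp (.all 0 (imp (mem (.var 0) omega) (tr A)))
    (tr (.all 0 (imp (mem (.var 0) omega) A)))

/-! ## Semantics -/

/-- A set of sentences is full if it is stroked (`↓ A B` belongs to it just if neither `A` nor `B`
does) and exhaustive (`∀ v A` belongs to it just if all instances by constants do). -/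
structure Full (S : Set Fm) : Prop where
  sentences : ∀ A ∈ S, A.Closed
  stroked : ∀ A B : Fm, A.Closed → B.Closed → (Expr.nor A B ∈ S ↔ A ∉ S ∧ B ∉ S)
  exhaustive : ∀ (v : ℕ) (A : Fm), (Expr.all v A).Closed →
    (Expr.all v A ∈ S ↔ ∀ b : Tm, b.Closed → A.subst v b ∈ S)

/-- `A` belongs to `s δ` for all `δ` from some ordinal below `α` onwards and below `α`. -/
def StableBelow (s : Ordinal.{0} → Set Fm) (α : Ordinal.{0}) (A : Fm) : Prop :=
  ∃ γ < α, ∀ δ, γ ≤ δ → δ < α → A ∈ s δ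

/-- `bar n α` is the barter at `α` on `n`. At `0` the barters enumerate the collection `CD` of
initial full sets; at `α > 0` they are full sets that satisfy the revision clauses for the truth
predicate and for set abstracts. Nothing is required of the remaining atomic sentences. -/
structure IsBarter {Ω : Type} (CD : Set (Set Fm)) (bar : Ω → Ordinal.{0} → Set Fm) : Prop where
  initial : Set.range (fun n => bar n 0) = CD
  full : ∀ n α, Full (bar n α)
  truth : ∀ n α, 0 < α → ∀ A : Fm, A.Closed →
    (tr A ∈ bar n α ↔ StableBelow (bar n) α A)
  sets : ∀ n α, 0 < α → ∀ (v : ℕ) (A : Fm) (a : Tm), (Expr.abs v A).Closed → a.Closed →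
    (mem a (.abs v A) ∈ bar n α ↔ StableBelow (bar n) α (A.subst v a))

section

variable {Ω : Type} (bar : Ω → Ordinal.{0} → Set Fm)

/-- `A` holds at `α` according to all barters. -/
def HoldsAt (α : Ordinal.{0}) (A : Fm) : Prop := ∀ n, A ∈ bar n α

/-- `𝒯⌜A⌝` holds at all ordinals from `α` onwards. -/
def InFrom (α : Ordinal.{0}) (A : Fm) : Prop := ∀ β, α ≤ β → HoldsAt bar β (tr A)

/-- `𝒯⌜A⌝` holds at all ordinals from some ordinal onwards. -/
def In (A : Fm) : Prop := ∃ α, InFrom bar α A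

/-- `α` covers `A`. -/
def Covers (α : Ordinal.{0}) (A : Fm) : Prop := In bar A → InFrom bar α A

/-- `α` stabilizes `A`. -/
def Stabilizes (α : Ordinal.{0}) (A : Fm) : Prop :=
  Covers bar α A ∧ (HoldsAt bar α (tr A) → In bar A)

/-- The closure ordinal `ϖ`: the least ordinal that stabilizes all sentences. -/
noncomputable def closureOrdinal : Ordinal.{0} :=
  sInf {α | ∀ A : Fm, A.Closed → Stabilizes bar α A}

/-- `A` is a maxim, `⊩ᴹ A`: `𝒯⌜A⌝` is an element of all barters at the closure ordinal. -/
def Maxim (A : Fm) : Prop := ∀ n, tr A ∈ bar n (closureOrdinal bar)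

/-- `A` is a thesis, `⊩ A`: `¬ 𝒯⌜¬ A⌝` is an element of all barters at the closure ordinal. -/
def Thesis (A : Fm) : Prop := ∀ n, neg (tr (neg A)) ∈ bar n (closureOrdinal bar)

end

end Libra

/-!
The argument follows a barter through blocks of `ω` successive ordinals. On such a block the
revision clauses only relate a stage to the next one (`IsRun`), and when a block starts at a limit,
its first member records what held at all but finitely many stages of the block before
(`IsLimitRun`).

Along a block `r ∈ r` changes at each step, and it fails at limits. Hence, in a block that starts at
a limit, `r ∈ t` holds exactly at the first step after it, and `r` belongs to the `k`-fold
`{v | v ∈ ⋯ t}` at the step `k + 1`, while the pair of the numeral of `k` and this set is always in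
`t_ω`. So `∀ x B(x)` fails at each
stage of a block other than the first. On the other hand, each single instance `B(c)` is eventually
true in the block: a constant `c` that is paired by `t_ω` with some `w` contains `r` at the stage
`i + 1` only if `w` was eventually identical to the numeral of `i` before the limit, and that can
be so for one `i` only. This is `IsLimitRun.eventually_eq_numeral_of_mem_tOmega`, proved by an
induction in `t_ω` with a property that a single formula defines, since the finitely many stages
passed since the limit can be recalled at the current one. Identity may behave wildly, because
nothing is required of membership in `ℱ`; all that is used is that constants identical at a
successor stage are indiscernible at the stage before, so that decoding a Kuratowski pair costs
five stages. The same invariant, read in the first component of the pair, serves for the formula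
`∀ y (⟨x, y⟩ ∈ t_ω → r ∉ y)` with a delay of seven stages, which refutes the schema on which
McGee's argument relies.

Therefore `∀ x 𝒯B(x)` holds and `𝒯∀ x B(x)` fails at every ordinal `ν + ω + ω`, whereas the Barcan
schema holds at all successors. As a maxim holds at all sufficiently large ordinals, the schema is
not a maxim. For the theses it remains to see that both kinds of ordinals are cofinal below the
closure ordinal `ϖ`, that is, that `ϖ` is a limit of limits. It is not finite because of the
sentences `𝒯⋯𝒯A` with `A` valid, not a successor because `r ∈ r` is decided uniformly from `ω`
onwards, and not of the form `ν + ω` because `r ∉ t` is stable below such ordinals without being a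
maxim.
-/

namespace Libra

open Filter

/-! ### Substitution and closed expressions -/

theorem subst_of_notMem {k : Kind} (X : Expr k) (v : ℕ) (a : Tm) (h : v ∉ X.fv) :
    X.subst v a = X := by
  induction X with
  | var n => simp only [Expr.fv, Finset.mem_singleton] at h; simp [Expr.subst, Ne.symm h]
  | truth => rfl
  | falsity => rfl
  | abs w A ih | all w A ih =>
    simp only [Expr.fv, Finset.mem_erase, not_and] at h
    by_cases hw : w = v
    · simp [Expr.subst, hw]
    · simp [Expr.subst, hw, ih (h (Ne.symm hw))]
  | name X ih => simp [Expr.subst, ih h]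
  | app b c ihb ihc | nor b c ihb ihc =>
    simp only [Expr.fv, Finset.mem_union, not_or] at h
    simp [Expr.subst, ihb h.1, ihc h.2]

theorem subst_of_closed {k : Kind} {X : Expr k} (h : X.Closed) (v : ℕ) (a : Tm) :
    X.subst v a = X :=
  subst_of_notMem X v a (by rw [h]; simp)

theorem fv_subst {k : Kind} (X : Expr k) (v : ℕ) {a : Tm} (ha : a.Closed) :
    (X.subst v a).fv = X.fv.erase v := by
  induction X with
  | var n =>
    by_cases hn : n = v
    · subst hn; simp [Expr.subst, Expr.fv, show a.fv = ∅ from ha]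
    · simp [Expr.subst, Expr.fv, hn, Finset.erase_eq_of_notMem, Ne.symm hn]
  | truth => simp [Expr.subst, Expr.fv]
  | falsity => simp [Expr.subst, Expr.fv]
  | abs w A ih | all w A ih =>
    by_cases hw : w = v
    · subst hw; simp [Expr.subst, Expr.fv]
    · simp [Expr.subst, Expr.fv, hw, ih, Finset.erase_right_comm]
  | name X ih => simp [Expr.subst, Expr.fv, ih]
  | app b c ihb ihc | nor b c ihb ihc =>
    simp [Expr.subst, Expr.fv, ihb, ihc, Finset.erase_union_distrib]

theorem closed_subst {k : Kind} {X : Expr k} {v : ℕ} (hX : X.fv ⊆ {v}) {a : Tm}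
    (ha : a.Closed) : (X.subst v a).Closed := by
  rw [Expr.Closed, fv_subst X v ha]
  ext i
  simp only [Finset.mem_erase, Finset.notMem_empty, iff_false, not_and]
  exact fun hi h => hi (Finset.mem_singleton.1 (hX h))

theorem fv_subset_of_erase {s : Finset ℕ} {v : ℕ} (h : s.erase v = ∅) : s ⊆ {v} := by
  intro i hi
  by_contra hne
  have : i ∈ s.erase v := Finset.mem_erase.2 ⟨by simpa using hne, hi⟩
  simp [h] at this

theorem closed_all {v : ℕ} {A : Fm} : (Expr.all v A).Closed ↔ A.fv ⊆ {v} := by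
  refine ⟨fv_subset_of_erase, fun h => ?_⟩
  ext i
  simp only [Expr.fv, Finset.mem_erase, Finset.notMem_empty, iff_false, not_and]
  exact fun hi hm => hi (Finset.mem_singleton.1 (h hm))

theorem closed_abs {v : ℕ} {A : Fm} : (Expr.abs v A).Closed ↔ A.fv ⊆ {v} := by
  rw [← closed_all, Expr.Closed, Expr.Closed, Expr.fv, Expr.fv]

@[simp] theorem closed_nor {A B : Fm} : (Expr.nor A B).Closed ↔ A.Closed ∧ B.Closed := by
  simp [Expr.Closed, Expr.fv, Finset.union_eq_empty]

@[simp] theorem closed_neg {A : Fm} : (neg A).Closed ↔ A.Closed := by simp [neg]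

@[simp] theorem closed_conj {A B : Fm} : (conj A B).Closed ↔ A.Closed ∧ B.Closed := by
  simp [conj]

@[simp] theorem closed_disj {A B : Fm} : (disj A B).Closed ↔ A.Closed ∧ B.Closed := by
  simp [disj]

@[simp] theorem closed_imp {A B : Fm} : (imp A B).Closed ↔ A.Closed ∧ B.Closed := by
  simp [imp]

@[simp] theorem closed_mem {a b : Tm} : (mem a b).Closed ↔ a.Closed ∧ b.Closed := by
  simp [mem, Expr.Closed, Expr.fv, Finset.union_eq_empty, and_comm]

@[simp] theorem closed_tr {A : Fm} : (tr A).Closed ↔ A.Closed := by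
  simp [tr, Expr.Closed, Expr.fv, mem]

@[simp] theorem fv_neg (A : Fm) : (neg A).fv = A.fv := by simp [neg, Expr.fv]

@[simp] theorem fv_conj (A B : Fm) : (conj A B).fv = A.fv ∪ B.fv := by simp [conj, Expr.fv]

@[simp] theorem fv_disj (A B : Fm) : (disj A B).fv = A.fv ∪ B.fv := by simp [disj, Expr.fv]

@[simp] theorem fv_imp (A B : Fm) : (imp A B).fv = A.fv ∪ B.fv := by simp [imp]

@[simp] theorem fv_ex (v : ℕ) (A : Fm) : (ex v A).fv = A.fv.erase v := by simp [ex, Expr.fv]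

@[simp] theorem fv_mem (a b : Tm) : (mem a b).fv = a.fv ∪ b.fv := by
  simp [mem, Expr.fv, Finset.union_comm]

@[simp] theorem fv_tr (A : Fm) : (tr A).fv = A.fv := by simp [tr, Expr.fv]

/-- The variable `v_6` is lost because the abbreviation binds it, also where it occurs in `a` or
`b`; likewise for `v_6`, `v_7` and `v_4` in the abbreviations below. -/
theorem fv_eq (a b : Tm) : (eq a b).fv = (a.fv ∪ b.fv).erase 6 := by
  ext i; simp [eq, Expr.fv]

theorem fv_upair (a b : Tm) : (upair a b).fv = ((a.fv ∪ b.fv).erase 6).erase 7 := by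
  ext i; simp [upair, Expr.fv, fv_eq]; tauto

theorem fv_opair (a b : Tm) : (opair a b).fv = ((a.fv ∪ b.fv).erase 6).erase 7 := by
  ext i; simp [opair, fv_upair]; tauto

theorem fv_elems (a : Tm) : (elems a).fv = a.fv.erase 4 := by
  ext i; simp [elems, Expr.fv]

theorem fv_succ (a : Tm) : (succ a).fv = a.fv.erase 7 := by
  ext i; simp [succ, Expr.fv, fv_eq]; tauto

@[simp] theorem closed_empty : empty.Closed := show empty.fv = ∅ by decide

@[simp] theorem closed_omega : omega.Closed := show omega.fv = ∅ by decide

@[simp] theorem closed_russell : russell.Closed := show russell.fv = ∅ by decide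

@[simp] theorem closed_tSet : tSet.Closed := show tSet.fv = ∅ by decide

@[simp] theorem closed_tOmega : tOmega.Closed := show tOmega.fv = ∅ by decide

theorem closed_eq {a b : Tm} (ha : a.Closed) (hb : b.Closed) : (eq a b).Closed := by
  rw [Expr.Closed, fv_eq, ha, hb]; rfl

theorem closed_upair {a b : Tm} (ha : a.Closed) (hb : b.Closed) : (upair a b).Closed := by
  rw [Expr.Closed, fv_upair, ha, hb]; rfl

theorem closed_opair {a b : Tm} (ha : a.Closed) (hb : b.Closed) : (opair a b).Closed :=
  closed_upair (closed_upair ha ha) (closed_upair ha hb)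

theorem closed_elems {a : Tm} (ha : a.Closed) : (elems a).Closed := by
  rw [Expr.Closed, fv_elems, ha]; rfl

theorem closed_succ {a : Tm} (ha : a.Closed) : (succ a).Closed := by
  rw [Expr.Closed, fv_succ, ha]; rfl

section Subst

variable (v : ℕ) (c : Tm)

@[simp] theorem subst_neg (A : Fm) : (neg A).subst v c = neg (A.subst v c) := rfl

@[simp] theorem subst_conj (A B : Fm) :
    (conj A B).subst v c = conj (A.subst v c) (B.subst v c) := rfl

@[simp] theorem subst_disj (A B : Fm) :
    (disj A B).subst v c = disj (A.subst v c) (B.subst v c) := rfl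

@[simp] theorem subst_imp (A B : Fm) :
    (imp A B).subst v c = imp (A.subst v c) (B.subst v c) := rfl

@[simp] theorem subst_mem (a b : Tm) :
    (mem a b).subst v c = mem (a.subst v c) (b.subst v c) := rfl

@[simp] theorem subst_tr (A : Fm) : (tr A).subst v c = tr (A.subst v c) := rfl

@[simp] theorem subst_var_self : (Expr.var v).subst v c = c := by simp [Expr.subst]

variable {v} in
theorem subst_var_of_ne {w : ℕ} (h : w ≠ v) : (Expr.var w).subst v c = .var w := by
  simp [Expr.subst, h]

variable {v}

theorem subst_all {w : ℕ} (h : w ≠ v) (A : Fm) :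
    (Expr.all w A).subst v c = .all w (A.subst v c) := by
  simp [Expr.subst, h]

theorem subst_ex {w : ℕ} (h : w ≠ v) (A : Fm) : (ex w A).subst v c = ex w (A.subst v c) := by
  simp [ex, Expr.subst, h, neg]

theorem subst_eq (h : v ≠ 6) (a b : Tm) :
    (eq a b).subst v c = eq (a.subst v c) (b.subst v c) := by
  simp [eq, Expr.subst, h.symm]

theorem subst_upair (h : v ≠ 6) (h' : v ≠ 7) (a b : Tm) :
    (upair a b).subst v c = upair (a.subst v c) (b.subst v c) := by
  simp [upair, Expr.subst, subst_eq, h, h'.symm]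

theorem subst_opair (h : v ≠ 6) (h' : v ≠ 7) (a b : Tm) :
    (opair a b).subst v c = opair (a.subst v c) (b.subst v c) := by
  simp [opair, subst_upair, h, h']

theorem subst_elems (h : v ≠ 4) (a : Tm) : (elems a).subst v c = elems (a.subst v c) := by
  simp [elems, Expr.subst, h.symm]

theorem subst_succ (h : v ≠ 6) (h' : v ≠ 7) (a : Tm) :
    (succ a).subst v c = succ (a.subst v c) := by
  simp [succ, Expr.subst, subst_eq, h, h'.symm]

end Subst

/-! ### Full sets -/

namespace Full

variable {S : Set Fm} (hS : Full S)
include hS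

theorem neg_mem {A : Fm} (hA : A.Closed) : neg A ∈ S ↔ A ∉ S := by
  rw [neg, hS.stroked A A hA hA, and_self]

theorem conj_mem {A B : Fm} (hA : A.Closed) (hB : B.Closed) :
    conj A B ∈ S ↔ A ∈ S ∧ B ∈ S := by
  rw [conj, hS.stroked _ _ (by simpa) (by simpa), hS.neg_mem hA, hS.neg_mem hB, not_not, not_not]

theorem disj_mem {A B : Fm} (hA : A.Closed) (hB : B.Closed) :
    disj A B ∈ S ↔ A ∈ S ∨ B ∈ S := by
  rw [disj, hS.neg_mem (by simp [hA, hB]), hS.stroked _ _ hA hB]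
  tauto

theorem imp_mem {A B : Fm} (hA : A.Closed) (hB : B.Closed) :
    imp A B ∈ S ↔ (A ∈ S → B ∈ S) := by
  rw [imp, hS.disj_mem (by simpa) hB, hS.neg_mem hA]
  tauto

theorem all_mem {v : ℕ} {A : Fm} (hA : A.fv ⊆ {v}) :
    Expr.all v A ∈ S ↔ ∀ b : Tm, b.Closed → A.subst v b ∈ S :=
  hS.exhaustive v A (closed_all.2 hA)

theorem ex_mem {v : ℕ} {A : Fm} (hA : A.fv ⊆ {v}) :
    ex v A ∈ S ↔ ∃ b : Tm, b.Closed ∧ A.subst v b ∈ S := by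
  rw [ex, hS.neg_mem (closed_all.2 (by rwa [fv_neg])), hS.all_mem (by rwa [fv_neg])]
  push Not
  refine exists_congr fun b => and_congr_right fun hb => ?_
  rw [subst_neg, hS.neg_mem (closed_subst hA hb), not_not]

theorem eq_mem {a b : Tm} (ha : a.Closed) (hb : b.Closed) :
    eq a b ∈ S ↔ ∀ u : Tm, u.Closed → mem a u ∈ S → mem b u ∈ S := by
  rw [eq, hS.all_mem (by simp [show a.fv = ∅ from ha, show b.fv = ∅ from hb, Expr.fv])]
  refine forall₂_congr fun u hu => ?_
  simp only [subst_imp, subst_mem, subst_of_closed ha, subst_of_closed hb, subst_var_self]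
  exact hS.imp_mem (by simp [ha, hu]) (by simp [hb, hu])

theorem eq_refl {a : Tm} (ha : a.Closed) : eq a a ∈ S :=
  (hS.eq_mem ha ha).2 fun _ _ h => h

end Full

/-! ### Definable properties and indiscernibility -/

/-- A property of constants is definable in `S` if some formula in the free variable `v_0` holds in
`S` of exactly the constants that have the property. -/
def Definable (S : Set Fm) (P : Tm → Prop) : Prop :=
  ∃ C : Fm, C.fv ⊆ {0} ∧ ∀ a : Tm, a.Closed → (C.subst 0 a ∈ S ↔ P a)

/-- Two constants are indiscernible in `S` if they share all properties definable in `S`. -/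
def Indisc (S : Set Fm) (a b : Tm) : Prop := ∀ P, Definable S P → (P a ↔ P b)

theorem Indisc.symm {S : Set Fm} {a b : Tm} (h : Indisc S a b) : Indisc S b a :=
  fun P hP => (h P hP).symm

theorem Indisc.trans {S : Set Fm} {a b c : Tm} (h : Indisc S a b) (h' : Indisc S b c) :
    Indisc S a c :=
  fun P hP => (h P hP).trans (h' P hP)

theorem Definable.congr {S : Set Fm} {P Q : Tm → Prop} (hP : Definable S P)
    (h : ∀ a, P a ↔ Q a) : Definable S Q :=
  (funext fun a => propext (h a) : P = Q) ▸ hP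

theorem Definable.not {S : Set Fm} (hS : Full S) {P : Tm → Prop} (hP : Definable S P) :
    Definable S fun x => ¬ P x := by
  obtain ⟨C, hC, h⟩ := hP
  exact ⟨neg C, by simpa using hC, fun a ha => by
    rw [subst_neg, hS.neg_mem (closed_subst hC ha), h a ha]⟩

theorem Definable.and {S : Set Fm} (hS : Full S) {P Q : Tm → Prop} (hP : Definable S P)
    (hQ : Definable S Q) : Definable S fun x => P x ∧ Q x := by
  obtain ⟨C, hC, h⟩ := hP
  obtain ⟨D, hD, h'⟩ := hQ
  exact ⟨conj C D, by simpa using Finset.union_subset hC hD, fun a ha => by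
    rw [subst_conj, hS.conj_mem (closed_subst hC ha) (closed_subst hD ha), h a ha, h' a ha]⟩

theorem definable_true {S : Set Fm} (hS : Full S) : Definable S fun _ => True :=
  ⟨eq empty empty, by decide, fun a _ => by
    rw [subst_of_closed (closed_eq closed_empty closed_empty)]
    simp [hS.eq_refl]⟩

theorem definable_false {S : Set Fm} (hS : Full S) : Definable S fun _ => False := by
  simpa using (definable_true hS).not hS

theorem definable_forall_lt {S : Set Fm} (hS : Full S) (P : ℕ → Tm → Prop) (n : ℕ)
    (hP : ∀ i < n, Definable S (P i)) : Definable S fun x => ∀ i < n, P i x := by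
  induction n with
  | zero => simpa using definable_true hS
  | succ n ih =>
    have h := (ih fun i hi => hP i (hi.trans n.lt_succ_self)).and hS (hP n n.lt_succ_self)
    simpa only [Nat.lt_succ_iff_lt_or_eq, or_imp, forall_and, forall_eq] using h

theorem definable_mem_left (S : Set Fm) {c : Tm} (hc : c.Closed) :
    Definable S fun x => mem x c ∈ S :=
  ⟨mem (.var 0) c, by simp [Expr.fv, show c.fv = ∅ from hc], fun a _ => by
    simp [subst_of_closed hc]⟩

theorem definable_mem_right (S : Set Fm) {c : Tm} (hc : c.Closed) :
    Definable S fun x => mem c x ∈ S :=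
  ⟨mem c (.var 0), by simp [Expr.fv, show c.fv = ∅ from hc], fun a _ => by
    simp [subst_of_closed hc]⟩

theorem definable_eq_right (S : Set Fm) {c : Tm} (hc : c.Closed) :
    Definable S fun x => eq x c ∈ S :=
  ⟨eq (.var 0) c, by simp [fv_eq, Expr.fv, show c.fv = ∅ from hc], fun a _ => by
    simp [subst_eq, subst_of_closed hc]⟩

/-! ### The bodies of the set abstracts -/

section Bodies

variable {S : Set Fm} (hS : Full S)
include hS

theorem upair_body {a b x : Tm} (ha : a.Closed) (hb : b.Closed) (hx : x.Closed) :
    (disj (eq (.var 7) a) (eq (.var 7) b)).subst 7 x ∈ S ↔ eq x a ∈ S ∨ eq x b ∈ S := by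
  simp [subst_eq, subst_of_closed ha, subst_of_closed hb,
    hS.disj_mem (closed_eq hx ha) (closed_eq hx hb)]

theorem succ_body {a x : Tm} (ha : a.Closed) (hx : x.Closed) :
    (disj (mem (.var 7) a) (eq (.var 7) a)).subst 7 x ∈ S ↔ mem x a ∈ S ∨ eq x a ∈ S := by
  simp [subst_eq, subst_of_closed ha, hS.disj_mem (closed_mem.2 ⟨hx, ha⟩) (closed_eq hx ha)]

theorem empty_body {x : Tm} (hx : x.Closed) : (neg (eq (.var 7) (.var 7))).subst 7 x ∉ S := by
  simp [subst_eq, hS.neg_mem (closed_eq hx hx), hS.eq_refl hx]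

theorem tSet_body_russell :
    (conj (eq (.var 0) russell)
      (conj (neg (mem (.var 0) (.var 0))) (neg (tr (mem (.var 0) (.var 0)))))).subst 0 russell ∈ S ↔
    mem russell russell ∉ S ∧ tr (mem russell russell) ∉ S := by
  simp [subst_eq, subst_of_closed, hS.conj_mem, hS.neg_mem, closed_eq, hS.eq_refl]

theorem all_all_mem {A : Fm} (hA : A.fv ⊆ {1, 2}) :
    Expr.all 1 (.all 2 A) ∈ S ↔
      ∀ y z : Tm, y.Closed → z.Closed → (A.subst 1 y).subst 2 z ∈ S := by
  have h : (Expr.all 2 A).fv ⊆ {1} := by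
    intro i hi
    have := hA (Finset.mem_of_mem_erase hi)
    have := Finset.ne_of_mem_erase hi
    simp_all
  rw [hS.all_mem h]
  refine forall_congr' fun y => ⟨fun H z hy hz => ?_, fun H hy => ?_⟩
  · have h2 := H hy
    rw [subst_all y (by decide), hS.all_mem (closed_all.1 ?_)] at h2
    · exact h2 z hz
    · simpa [subst_all] using closed_subst h hy
  · rw [subst_all y (by decide), hS.all_mem (closed_all.1 ?_)]
    · exact fun z hz => H z hy hz
    · simpa [subst_all] using closed_subst h hy

theorem tOmega_step {X : Tm} (hX : X.Closed) :
    Expr.all 1 (.all 2 (imp (mem (opair (.var 1) (.var 2)) X)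
      (mem (opair (succ (.var 1)) (elems (.var 2))) X))) ∈ S ↔
    ∀ y z : Tm, y.Closed → z.Closed → mem (opair y z) X ∈ S →
      mem (opair (succ y) (elems z)) X ∈ S := by
  rw [all_all_mem hS (by
    simp [fv_opair, fv_succ, fv_elems, Expr.fv, show X.fv = ∅ from hX])]
  refine forall₂_congr fun y z => forall₂_congr fun hy hz => ?_
  rw [← hS.imp_mem (by simp [closed_opair, *])
    (by simp [closed_opair, closed_succ, closed_elems, *])]
  simp [subst_opair, subst_succ, subst_elems, subst_of_closed, subst_var_of_ne, *]

theorem tOmega_body {u : Tm} (hu : u.Closed) :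
    (Expr.all 0 (imp
      (conj (mem (opair empty tSet) (.var 0))
        (.all 1 (.all 2 (imp
          (mem (opair (.var 1) (.var 2)) (.var 0))
          (mem (opair (succ (.var 1)) (elems (.var 2))) (.var 0))))))
      (mem (.var 3) (.var 0)))).subst 3 u ∈ S ↔
    ∀ X : Tm, X.Closed → mem (opair empty tSet) X ∈ S →
      (∀ y z : Tm, y.Closed → z.Closed → mem (opair y z) X ∈ S →
        mem (opair (succ y) (elems z)) X ∈ S) → mem u X ∈ S := by
  have hb : (opair empty tSet).Closed := closed_opair closed_empty closed_tSet
  rw [subst_all u (by decide), hS.all_mem (closed_all.1 (by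
    rw [← subst_all u (by decide)]; exact closed_subst (by decide) hu))]
  refine forall₂_congr fun X hX => ?_
  have hstep : (Expr.all 1 (.all 2 (imp (mem (opair (.var 1) (.var 2)) X)
      (mem (opair (succ (.var 1)) (elems (.var 2))) X)))).Closed := by
    simp only [Expr.Closed, Expr.fv, fv_imp, fv_mem, fv_opair, fv_succ, fv_elems,
      show X.fv = ∅ from hX]
    decide
  rw [← tOmega_step hS hX, ← and_imp, ← hS.conj_mem (by simp [hb, hX]) hstep,
    ← hS.imp_mem (by simp [hb, hX, hstep]) (by simp [hu, hX])]
  simp [subst_all, subst_opair, subst_succ, subst_elems, subst_var_of_ne, subst_of_closed, *]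

theorem omega_body {u : Tm} (hu : u.Closed) :
    (Expr.all 1 (imp
      (conj (mem empty (.var 1))
        (.all 2 (imp (mem (.var 2) (.var 1)) (mem (succ (.var 2)) (.var 1)))))
      (mem (.var 0) (.var 1)))).subst 0 u ∈ S ↔
    ∀ X : Tm, X.Closed → mem empty X ∈ S →
      (∀ z : Tm, z.Closed → mem z X ∈ S → mem (succ z) X ∈ S) → mem u X ∈ S := by
  rw [subst_all u (by decide), hS.all_mem (closed_all.1 (by
    rw [← subst_all u (by decide)]; exact closed_subst (by decide) hu))]
  refine forall₂_congr fun X hX => ?_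
  have hfv : (imp (mem (.var 2) X) (mem (succ (.var 2)) X)).fv ⊆ {2} := by
    simp only [Expr.fv, fv_imp, fv_mem, fv_succ, show X.fv = ∅ from hX]
    decide
  have hstep : (∀ z : Tm, z.Closed → mem z X ∈ S → mem (succ z) X ∈ S) ↔
      Expr.all 2 (imp (mem (.var 2) X) (mem (succ (.var 2)) X)) ∈ S := by
    rw [hS.all_mem hfv]
    refine forall₂_congr fun z hz => ?_
    rw [← hS.imp_mem (by simp [hz, hX]) (by simp [closed_succ, hz, hX])]
    simp [subst_succ, subst_of_closed hX]
  rw [hstep, ← and_imp, ← hS.conj_mem (by simp [hX]) (closed_all.2 hfv),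
    ← hS.imp_mem (by simp [hX, closed_all.2 hfv]) (by simp [hu, hX])]
  simp [subst_all, subst_succ, subst_var_of_ne, subst_of_closed, *]

end Bodies

/-! ### Runs of barters -/

/-- A sequence of full sets which, like the barters at `α, α + 1, α + 2, …`, satisfies the revision
clauses from each member to the next. -/
structure IsRun (σ : ℕ → Set Fm) : Prop where
  full : ∀ n, Full (σ n)
  truth : ∀ n (A : Fm), A.Closed → (tr A ∈ σ (n + 1) ↔ A ∈ σ n)
  sets : ∀ n (v : ℕ) (A : Fm) (a : Tm), (Expr.abs v A).Closed → a.Closed →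
    (mem a (.abs v A) ∈ σ (n + 1) ↔ A.subst v a ∈ σ n)

namespace IsRun

variable {σ : ℕ → Set Fm} (h : IsRun σ)
include h

theorem mem_upair {n : ℕ} {a b x : Tm} (ha : a.Closed) (hb : b.Closed) (hx : x.Closed) :
    mem x (upair a b) ∈ σ (n + 1) ↔ eq x a ∈ σ n ∨ eq x b ∈ σ n :=
  (h.sets n _ _ x (closed_upair ha hb) hx).trans (upair_body (h.full n) ha hb hx)

theorem mem_succ {n : ℕ} {a x : Tm} (ha : a.Closed) (hx : x.Closed) :
    mem x (succ a) ∈ σ (n + 1) ↔ mem x a ∈ σ n ∨ eq x a ∈ σ n :=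
  (h.sets n _ _ x (closed_succ ha) hx).trans (succ_body (h.full n) ha hx)

theorem not_mem_empty {n : ℕ} {x : Tm} (hx : x.Closed) : mem x empty ∉ σ (n + 1) :=
  fun H => empty_body (h.full n) hx ((h.sets n _ _ x closed_empty hx).1 H)

theorem mem_elems {n : ℕ} {a x : Tm} (ha : a.Closed) (hx : x.Closed) :
    mem x (elems a) ∈ σ (n + 1) ↔ mem x a ∈ σ n := by
  rw [elems, h.sets n _ _ x (closed_elems ha) hx]
  simp [subst_of_closed ha]

theorem mem_elems_iterate {n : ℕ} {a x : Tm} (ha : a.Closed) (hx : x.Closed) (k : ℕ) :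
    mem x (elems^[k] a) ∈ σ (n + k) ↔ mem x a ∈ σ n := by
  induction k generalizing a n with
  | zero => rfl
  | succ k ih =>
    rw [Function.iterate_succ_apply, show n + (k + 1) = n + 1 + k by omega, ih (closed_elems ha),
      h.mem_elems ha hx]

theorem mem_russell {n : ℕ} : mem russell russell ∈ σ (n + 1) ↔ mem russell russell ∉ σ n := by
  rw [← (h.full n).neg_mem (by simp)]
  exact h.sets n _ _ _ closed_russell closed_russell

theorem russell_mem_tSet {n : ℕ} :
    mem russell tSet ∈ σ (n + 1) ↔
      mem russell russell ∉ σ n ∧ tr (mem russell russell) ∉ σ n :=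
  (h.sets n _ _ _ closed_tSet closed_russell).trans (tSet_body_russell (h.full n))

/-- `r ∉ r` and `¬ 𝒯⌜r ∈ r⌝` are incompatible after a successor step. -/
theorem russell_notMem_tSet (n : ℕ) : mem russell tSet ∉ σ (n + 2) := by
  rw [h.russell_mem_tSet, h.mem_russell, h.truth _ _ (by simp)]
  tauto

theorem mem_tOmega {n : ℕ} {u : Tm} (hu : u.Closed) :
    mem u tOmega ∈ σ (n + 1) ↔
      ∀ X : Tm, X.Closed → mem (opair empty tSet) X ∈ σ n →
        (∀ y z : Tm, y.Closed → z.Closed → mem (opair y z) X ∈ σ n →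
          mem (opair (succ y) (elems z)) X ∈ σ n) → mem u X ∈ σ n :=
  (h.sets n _ _ u closed_tOmega hu).trans (tOmega_body (h.full n) hu)

theorem mem_abs_of_definable {n : ℕ} {P : Tm → Prop} (hP : Definable (σ n) P) :
    ∃ X : Tm, X.Closed ∧ ∀ a : Tm, a.Closed → (mem a X ∈ σ (n + 1) ↔ P a) := by
  obtain ⟨C, hC, hP⟩ := hP
  exact ⟨.abs 0 C, closed_abs.2 hC, fun a ha =>
    (h.sets n 0 C a (closed_abs.2 hC) ha).trans (hP a ha)⟩

/-- Finitely many stages back can be recalled: `{v_0 | C}` has at a stage the members that satisfied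
`C` at the stage before. -/
theorem definable_succ {n : ℕ} {P : Tm → Prop} (hP : Definable (σ n) P) :
    Definable (σ (n + 1)) P := by
  obtain ⟨X, hX, hP⟩ := h.mem_abs_of_definable hP
  obtain ⟨C, hC, H⟩ := definable_mem_left (σ (n + 1)) hX
  exact ⟨C, hC, fun a ha => (H a ha).trans (hP a ha)⟩

theorem definable_of_le {m n : ℕ} (hmn : m ≤ n) {P : Tm → Prop} (hP : Definable (σ m) P) :
    Definable (σ n) P := by
  induction hmn with
  | refl => exact hP
  | step _ ih => exact h.definable_succ ih

/-- Identity at a successor stage is indiscernibility at the stage before. -/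
theorem indisc_of_eq {n : ℕ} {a b : Tm} (ha : a.Closed) (hb : b.Closed)
    (hab : eq a b ∈ σ (n + 1)) : Indisc (σ n) a b := by
  have key : ∀ P, Definable (σ n) P → P a → P b := by
    intro P hP hPa
    obtain ⟨X, hX, H⟩ := h.mem_abs_of_definable hP
    exact (H b hb).1 (((h.full _).eq_mem ha hb).1 hab X hX ((H a ha).2 hPa))
  exact fun P hP => ⟨key P hP, not_imp_not.1 (key _ (hP.not (h.full n)))⟩

theorem indisc_or_of_eq_upair {n : ℕ} {a b c d : Tm} (ha : a.Closed) (hb : b.Closed)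
    (hc : c.Closed) (hd : d.Closed) (H : eq (upair a b) (upair c d) ∈ σ (n + 3)) :
    (Indisc (σ n) a c ∨ Indisc (σ n) a d) ∧ (Indisc (σ n) b c ∨ Indisc (σ n) b d) ∧
      (Indisc (σ n) c a ∨ Indisc (σ n) c b) ∧ (Indisc (σ n) d a ∨ Indisc (σ n) d b) := by
  have hI := h.indisc_of_eq (closed_upair ha hb) (closed_upair hc hd) H
  have key : ∀ x : Tm, x.Closed →
      ((eq x a ∈ σ (n + 1) ∨ eq x b ∈ σ (n + 1)) ↔ (eq x c ∈ σ (n + 1) ∨ eq x d ∈ σ (n + 1))) := by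
    intro x hx
    rw [← h.mem_upair ha hb hx, ← h.mem_upair hc hd hx]
    exact hI _ (definable_mem_right _ hx)
  have hr : ∀ x : Tm, x.Closed → eq x x ∈ σ (n + 1) := fun x hx => (h.full _).eq_refl hx
  exact ⟨((key a ha).1 (.inl (hr a ha))).imp (h.indisc_of_eq ha hc) (h.indisc_of_eq ha hd),
    ((key b hb).1 (.inr (hr b hb))).imp (h.indisc_of_eq hb hc) (h.indisc_of_eq hb hd),
    ((key c hc).2 (.inl (hr c hc))).imp (h.indisc_of_eq hc ha) (h.indisc_of_eq hc hb),
    ((key d hd).2 (.inr (hr d hd))).imp (h.indisc_of_eq hd ha) (h.indisc_of_eq hd hb)⟩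

/-- Kuratowski pairs are injective, at the price of five stages. -/
theorem indisc_of_eq_opair {n : ℕ} {a b c d : Tm} (ha : a.Closed) (hb : b.Closed)
    (hc : c.Closed) (hd : d.Closed) (H : eq (opair a b) (opair c d) ∈ σ (n + 5)) :
    Indisc (σ n) a c ∧ Indisc (σ n) b d := by
  have haa := closed_upair ha ha
  have hab := closed_upair ha hb
  have hcc := closed_upair hc hc
  have hcd := closed_upair hc hd
  have hI := h.indisc_of_eq (closed_opair ha hb) (closed_opair hc hd) H
  have key : ∀ x : Tm, x.Closed →
      ((eq x (upair a a) ∈ σ (n + 3) ∨ eq x (upair a b) ∈ σ (n + 3)) ↔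
        (eq x (upair c c) ∈ σ (n + 3) ∨ eq x (upair c d) ∈ σ (n + 3))) := by
    intro x hx
    rw [← h.mem_upair haa hab hx, ← h.mem_upair hcc hcd hx]
    exact hI _ (definable_mem_right _ hx)
  have hr : ∀ x : Tm, x.Closed → eq x x ∈ σ (n + 3) := fun x hx => (h.full _).eq_refl hx
  have hca : Indisc (σ n) c a := by
    rcases (key _ haa).1 (.inl (hr _ haa)) with e | e
    · exact ((h.indisc_or_of_eq_upair ha ha hc hc e).2.2.1).elim id id
    · exact ((h.indisc_or_of_eq_upair ha ha hc hd e).2.2.1).elim id id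
  have hbcd : Indisc (σ n) b c ∨ Indisc (σ n) b d := by
    rcases (key _ hab).1 (.inr (hr _ hab)) with e | e
    · exact .inl ((h.indisc_or_of_eq_upair ha hb hc hc e).2.1.elim id id)
    · exact (h.indisc_or_of_eq_upair ha hb hc hd e).2.1
  have hdab : Indisc (σ n) d a ∨ Indisc (σ n) d b := by
    rcases (key _ hcd).2 (.inr (hr _ hcd)) with e | e
    · exact .inl ((h.indisc_or_of_eq_upair hc hd ha ha e).2.1.elim id id)
    · exact (h.indisc_or_of_eq_upair hc hd ha hb e).2.1
  refine ⟨hca.symm, ?_⟩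
  rcases hbcd with hbc | hbd
  · rcases hdab with hda | hdb
    · exact hbc.trans (hca.trans hda.symm)
    · exact hdb.symm
  · exact hbd

/-- Induction in `t_ω` for definable properties. -/
theorem tOmega_induction {n : ℕ} {u : Tm} (hu : u.Closed) (H : mem u tOmega ∈ σ (n + 2))
    {P : Tm → Prop} (hP : Definable (σ n) P) (base : P (opair empty tSet))
    (step : ∀ y z : Tm, y.Closed → z.Closed → P (opair y z) → P (opair (succ y) (elems z))) :
    P u := by
  obtain ⟨X, hX, hXP⟩ := h.mem_abs_of_definable hP
  refine (hXP u hu).1 ((h.mem_tOmega hu).1 H X hX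
    ((hXP _ (closed_opair closed_empty closed_tSet)).2 base) fun y z hy hz hyz => ?_)
  exact (hXP _ (closed_opair (closed_succ hy) (closed_elems hz))).2
    (step y z hy hz ((hXP _ (closed_opair hy hz)).1 hyz))

/-- An implication between definable properties of the components of a pair is a definable property
of the pair. -/
theorem definable_forall_opair {n : ℕ} {U V : Tm → Prop} (hU : Definable (σ n) U)
    (hV : Definable (σ n) V) :
    Definable (σ (n + 1)) fun u => ∀ x z : Tm, x.Closed → z.Closed →
      eq u (opair x z) ∈ σ (n + 1) → U z → V x := by
  obtain ⟨X, hX, hXU⟩ := h.mem_abs_of_definable hU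
  obtain ⟨Y, hY, hYV⟩ := h.mem_abs_of_definable hV
  have hXf : X.fv = ∅ := hX
  have hYf : Y.fv = ∅ := hY
  have hS := h.full (n + 1)
  refine ⟨.all 1 (.all 2 (imp (eq (.var 0) (opair (.var 1) (.var 2)))
    (imp (mem (.var 2) X) (mem (.var 1) Y)))), ?_, fun u hu => ?_⟩
  · simp only [Expr.fv, fv_imp, fv_mem, fv_eq, fv_opair, hXf, hYf]
    decide
  · have huf : u.fv = ∅ := hu
    rw [subst_all u (by decide), subst_all u (by decide), all_all_mem hS]
    · refine forall₂_congr fun x z => forall₂_congr fun hx hz => ?_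
      rw [← hXU z hz, ← hYV x hx, ← hS.imp_mem (by simp [*]) (by simp [*]),
        ← hS.imp_mem (closed_eq hu (closed_opair hx hz)) (by simp [*])]
      simp [subst_eq, subst_opair, subst_of_closed, subst_var_of_ne, *]
    · simp [subst_eq, subst_opair, subst_of_closed, subst_var_of_ne, *, Expr.fv, fv_eq, fv_opair]
      decide

end IsRun

/-! ### Numerals -/

/-- The numeral `∅′⋯′` with `i` successor signs. -/
def numeral (i : ℕ) : Tm := succ^[i] empty

theorem numeral_succ (i : ℕ) : numeral (i + 1) = succ (numeral i) :=
  Function.iterate_succ_apply' _ _ _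

theorem closed_numeral (i : ℕ) : (numeral i).Closed := by
  induction i with
  | zero => exact closed_empty
  | succ i ih => rw [numeral_succ]; exact closed_succ ih

theorem closed_elems_iterate {a : Tm} (ha : a.Closed) (k : ℕ) : (elems^[k] a).Closed := by
  induction k with
  | zero => exact ha
  | succ k ih => rw [Function.iterate_succ_apply']; exact closed_elems ih

theorem eventually_atTop_succ {p : ℕ → Prop} :
    (∀ᶠ n in atTop, p (n + 1)) ↔ ∀ᶠ n in atTop, p n := by
  conv_rhs => rw [← map_add_atTop_eq_nat 1]
  exact eventually_map.symm

namespace IsRun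

variable {σ : ℕ → Set Fm} (h : IsRun σ)
include h

theorem eventually_numeral_mem {i j : ℕ} (hij : i < j) :
    ∀ᶠ n in atTop, mem (numeral i) (numeral j) ∈ σ n := by
  induction hij with
  | refl =>
    refine eventually_atTop_succ.1 (Eventually.of_forall fun n => ?_)
    rw [Nat.succ_eq_add_one, numeral_succ, h.mem_succ (closed_numeral i) (closed_numeral i)]
    exact .inr ((h.full n).eq_refl (closed_numeral i))
  | @step j _ ih =>
    refine eventually_atTop_succ.1 (ih.mono fun n hn => ?_)
    rw [Nat.succ_eq_add_one, numeral_succ, h.mem_succ (closed_numeral j) (closed_numeral i)]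
    exact .inl hn

/-- A numeral `j > i` contains `i`, so it can be identical to `i` only if `i ∈ i`. -/
theorem eventually_numeral_ne_of_notMem {i j : ℕ} (hij : i < j)
    (H : ∀ᶠ n in atTop, mem (numeral i) (numeral i) ∉ σ n) :
    ∀ᶠ n in atTop, eq (numeral j) (numeral i) ∉ σ n := by
  refine eventually_atTop_succ.1 ?_
  filter_upwards [H, h.eventually_numeral_mem hij] with n h1 h2 h3
  exact h1 ((h.indisc_of_eq (closed_numeral j) (closed_numeral i) h3 _
    (definable_mem_right _ (closed_numeral i))).1 h2)

theorem eventually_numeral_notMem {i j : ℕ} (hij : i ≤ j) :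
    ∀ᶠ n in atTop, mem (numeral j) (numeral i) ∉ σ n := by
  induction i generalizing j with
  | zero =>
    exact eventually_atTop_succ.1 (Eventually.of_forall fun n => h.not_mem_empty (closed_numeral j))
  | succ i ih =>
    refine eventually_atTop_succ.1 ?_
    filter_upwards [ih (Nat.le_of_succ_le hij),
      h.eventually_numeral_ne_of_notMem hij (ih le_rfl)] with n h1 h2
    rw [numeral_succ, h.mem_succ (closed_numeral i) (closed_numeral j)]
    exact not_or.2 ⟨h1, h2⟩

/-- No constant is eventually identical to two numerals. -/
theorem numeral_unique {w : Tm} (hw : w.Closed) {i j : ℕ}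
    (hi : ∀ᶠ n in atTop, eq w (numeral i) ∈ σ n) (hj : ∀ᶠ n in atTop, eq w (numeral j) ∈ σ n) :
    i = j := by
  wlog hij : i < j generalizing i j
  · rcases (not_lt.1 hij).lt_or_eq with hlt | heq
    · exact (this hj hi hlt).symm
    · exact heq.symm
  exfalso
  obtain ⟨n, h1, h2, h3⟩ := ((eventually_atTop_succ.2 hj).and
    (hi.and (h.eventually_numeral_ne_of_notMem hij (h.eventually_numeral_notMem le_rfl)))).exists
  exact h3 ((h.indisc_of_eq hw (closed_numeral j) h1 _
    (definable_eq_right _ (closed_numeral i))).1 h2)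

/-- Identity is a congruence for the successor, at the price of one stage. -/
theorem eventually_eq_succ {x y : Tm} (hx : x.Closed) (hy : y.Closed)
    (H : ∀ᶠ n in atTop, eq x y ∈ σ n) : ∀ᶠ n in atTop, eq (succ x) (succ y) ∈ σ n := by
  refine (eventually_atTop_succ.2 H).mono fun n hn => ?_
  have hyf : y.fv = ∅ := hy
  have hdef : Definable (σ n) fun x => eq (succ x) (succ y) ∈ σ n :=
    ⟨eq (succ (.var 0)) (succ y), by simp [fv_eq, fv_succ, Expr.fv, hyf], fun a _ => by
      simp [subst_eq, subst_succ, subst_of_closed hy]⟩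
  exact (h.indisc_of_eq hx hy hn _ hdef).2 ((h.full n).eq_refl (closed_succ hy))

/-- The pairs `⟨k, {v | v ∈ ⋯ t}⟩` that generate `t_ω` always belong to it. -/
theorem opair_numeral_mem_tOmega (n k : ℕ) :
    mem (opair (numeral k) (elems^[k] tSet)) tOmega ∈ σ (n + 1) := by
  have hc : ∀ k, (elems^[k] tSet).Closed := closed_elems_iterate closed_tSet
  rw [h.mem_tOmega (closed_opair (closed_numeral k) (hc k))]
  intro X _ base step
  induction k with
  | zero => exact base
  | succ k ih =>
    rw [numeral_succ, Function.iterate_succ_apply']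
    exact step _ _ (closed_numeral k) (hc k) ih

theorem numeral_mem_omega (n k : ℕ) : mem (numeral k) omega ∈ σ (n + 1) := by
  refine (h.sets n _ _ _ closed_omega (closed_numeral k)).2
    ((omega_body (h.full n) (closed_numeral k)).2 fun X _ base step => ?_)
  induction k with
  | zero => exact base
  | succ k ih => rw [numeral_succ]; exact step _ (closed_numeral k) ih

theorem not_eventually_russell : ¬ ∀ᶠ n in atTop, mem russell russell ∈ σ n := fun H => by
  obtain ⟨n, h1, h2⟩ := ((eventually_atTop_succ.2 H).and H).exists
  exact h.mem_russell.1 h1 h2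

theorem not_eventually_not_russell : ¬ ∀ᶠ n in atTop, mem russell russell ∉ σ n := fun H => by
  obtain ⟨n, h1, h2⟩ := ((eventually_atTop_succ.2 H).and H).exists
  exact h1 (h.mem_russell.2 h2)

theorem not_eventually_russell_mem_tSet : ¬ ∀ᶠ n in atTop, mem russell tSet ∈ σ n := fun H => by
  obtain ⟨n, hn⟩ := (eventually_atTop_succ.2 (eventually_atTop_succ.2 H)).exists
  exact h.russell_notMem_tSet n hn

end IsRun

/-! ### Runs that start at a limit -/

/-- The run `τ` starts at the limit of the run `σ`: the revision clauses of its first member refer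
to what holds in all but finitely many members of `σ`. -/
structure IsLimitRun (σ τ : ℕ → Set Fm) : Prop where
  left : IsRun σ
  right : IsRun τ
  truth : ∀ A : Fm, A.Closed → (tr A ∈ τ 0 ↔ ∀ᶠ n in atTop, A ∈ σ n)
  sets : ∀ (v : ℕ) (A : Fm) (a : Tm), (Expr.abs v A).Closed → a.Closed →
    (mem a (.abs v A) ∈ τ 0 ↔ ∀ᶠ n in atTop, A.subst v a ∈ σ n)

namespace IsLimitRun

variable {σ τ : ℕ → Set Fm} (h : IsLimitRun σ τ)
include h

theorem mem_elems {a x : Tm} (ha : a.Closed) (hx : x.Closed) :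
    mem x (elems a) ∈ τ 0 ↔ ∀ᶠ n in atTop, mem x a ∈ σ n := by
  rw [elems, h.sets _ _ x (closed_elems ha) hx]
  simp [subst_of_closed ha]

theorem russell_notMem : mem russell russell ∉ τ 0 := by
  refine fun H => h.left.not_eventually_not_russell ?_
  refine ((h.sets _ _ _ closed_russell closed_russell).1 H).mono fun n hn => ?_
  exact ((h.left.full n).neg_mem (by simp)).1 hn

/-- At a limit neither `r ∈ r` nor `r ∉ r` is stable, so both `r ∉ r` and `¬ 𝒯⌜r ∈ r⌝` hold
there. -/
theorem russell_mem_tSet : mem russell tSet ∈ τ 1 := by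
  refine h.right.russell_mem_tSet.2 ⟨h.russell_notMem, fun H => ?_⟩
  exact h.left.not_eventually_russell ((h.truth _ (by simp)).1 H)

theorem russell_notMem_tSet : mem russell tSet ∉ τ 0 := fun H => by
  have H' := (h.sets _ _ _ closed_tSet closed_russell).1 H
  obtain ⟨n, hn⟩ := (eventually_atTop_succ.2 H').exists
  have := (tSet_body_russell (h.left.full _)).1 hn
  rw [h.left.mem_russell, h.left.truth _ _ (by simp)] at this
  tauto

theorem russell_mem_elems_iterate (k : ℕ) : mem russell (elems^[k] tSet) ∈ τ (k + 1) := by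
  rw [add_comm, h.right.mem_elems_iterate closed_tSet closed_russell]
  exact h.russell_mem_tSet

/-- The sets `{v | v ∈ z}` make what was stable before the limit definable at the limit. -/
theorem definable_eventually_mem {c : Tm} (hc : c.Closed) :
    Definable (τ 0) fun z => ∀ᶠ n in atTop, mem c z ∈ σ n := by
  refine ⟨mem c (elems (.var 0)), by simp [fv_elems, Expr.fv, show c.fv = ∅ from hc],
    fun a ha => ?_⟩
  refine Iff.trans ?_ (h.mem_elems ha hc)
  simp [subst_elems, subst_of_closed hc]

theorem definable_eventually_eq {c : Tm} (hc : c.Closed) :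
    Definable (τ 0) fun x => ∀ᶠ n in atTop, eq x c ∈ σ n := by
  have hcl : (Expr.abs 0 (eq (.var 0) c)).Closed := closed_abs.2 (by
    simp [fv_eq, Expr.fv, show c.fv = ∅ from hc])
  refine ⟨mem (.var 0) (.abs 0 (eq (.var 0) c)), ?_, fun a ha => ?_⟩
  · simp [Expr.fv, fv_eq, show c.fv = ∅ from hc]
  · rw [subst_mem, subst_var_self, subst_of_closed hcl, h.sets _ _ _ hcl ha]
    simp [subst_eq, subst_of_closed hc]

end IsLimitRun

namespace IsLimitRun

variable {σ τ : ℕ → Set Fm} (h : IsLimitRun σ τ)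
include h

/-- The invariant of `t_ω`: as far as the stages up to `p` can tell, if `⟨w, c⟩` belongs to `t_ω`,
then `c` contains `r` only at stages `i + 1` for which `w` was eventually identical to the numeral
of `i` before the limit. The sets `{v | v ∈ z}` shift this pattern by one stage, and the two
conditions on `z` at and below the limit prevent `r` from entering anew at the limit. -/
theorem eventually_eq_numeral_of_mem_tOmega {p : ℕ} {w c : Tm} (hw : w.Closed) (hc : c.Closed)
    (H : mem (opair w c) tOmega ∈ τ (p + 7)) {i : ℕ} (hi : i < p)
    (hr : mem russell c ∈ τ (i + 1)) : ∀ᶠ n in atTop, eq w (numeral i) ∈ σ n := by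
  have hrun := h.right
  -- The five stages from `p` to `p + 5` are lost to the decoding of the pair.
  have hle : ∀ {m : ℕ} {U : Tm → Prop}, m ≤ p → Definable (τ m) U → Definable (τ p) U :=
    fun hm hU => hrun.definable_of_le hm hU
  have hup : ∀ {U : Tm → Prop}, Definable (τ p) U → Definable (τ (p + 4)) U :=
    fun hU => hrun.definable_of_le (by omega) hU
  have hU₁ := hle p.zero_le (h.definable_eventually_mem closed_russell)
  have hU₂ := hle p.zero_le (definable_mem_right (τ 0) closed_russell)
  have hU : ∀ j < p, Definable (τ p) fun z => mem russell z ∈ τ (j + 1) :=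
    fun j hj => hle hj (definable_mem_right _ closed_russell)
  have hV : ∀ j, Definable (τ p) fun x => ∀ᶠ n in atTop, eq x (numeral j) ∈ σ n :=
    fun j => hle p.zero_le (h.definable_eventually_eq (closed_numeral j))
  let R : Tm → Tm → Prop := fun x z => (¬ ∀ᶠ n in atTop, mem russell z ∈ σ n) ∧
    mem russell z ∉ τ 0 ∧
    ∀ j < p, mem russell z ∈ τ (j + 1) → ∀ᶠ n in atTop, eq x (numeral j) ∈ σ n
  have hR : ∀ {x z x' z' : Tm}, Indisc (τ p) x x' → Indisc (τ p) z z' → R x z → R x' z' := by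
    rintro x z x' z' hx hz ⟨h1, h2, h3⟩
    refine ⟨fun H => h1 ((hz _ hU₁).2 H), fun H => h2 ((hz _ hU₂).2 H), fun j hj H => ?_⟩
    exact (hx _ (hV j)).1 (h3 j hj ((hz _ (hU j hj)).2 H))
  have hdef : Definable (τ (p + 5)) fun u => ∀ x z : Tm, x.Closed → z.Closed →
      eq u (opair x z) ∈ τ (p + 5) → R x z := by
    have hF := definable_false (hrun.full (p + 4))
    have hS := hrun.full (p + 5)
    refine ((hrun.definable_forall_opair (hup hU₁) hF).and hS
      ((hrun.definable_forall_opair (hup hU₂) hF).and hS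
        (definable_forall_lt hS _ p fun j hj =>
          hrun.definable_forall_opair (hup (hU j hj)) (hup (hV j))))).congr fun u => ?_
    exact ⟨fun ⟨h1, h2, h3⟩ x z hx hz e =>
        ⟨h1 x z hx hz e, h2 x z hx hz e, fun j hj => h3 j hj x z hx hz e⟩,
      fun H => ⟨fun x z hx hz e => (H x z hx hz e).1, fun x z hx hz e => (H x z hx hz e).2.1,
        fun j hj x z hx hz e => (H x z hx hz e).2.2 j hj⟩⟩
  refine (hrun.tOmega_induction (closed_opair hw hc) H hdef ?_ ?_ w c hw hc
    ((hrun.full _).eq_refl (closed_opair hw hc))).2.2 i hi hr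
  · intro x z hx hz e
    obtain ⟨h1, h2⟩ := hrun.indisc_of_eq_opair closed_empty closed_tSet hx hz e
    refine hR h1 h2 ⟨h.left.not_eventually_russell_mem_tSet, h.russell_notMem_tSet, ?_⟩
    rintro (_ | j) _ H
    · exact Eventually.of_forall fun n => (h.left.full n).eq_refl closed_empty
    · exact absurd H (hrun.russell_notMem_tSet j)
  · intro y z hy hz ih x' z' hx' hz' e
    obtain ⟨h1, h2, h3⟩ := ih y z hy hz ((hrun.full _).eq_refl (closed_opair hy hz))
    obtain ⟨e1, e2⟩ := hrun.indisc_of_eq_opair (closed_succ hy) (closed_elems hz) hx' hz' e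
    refine hR e1 e2 ⟨fun H => h1 ?_, fun H => h1 ((h.mem_elems hz closed_russell).1 H), ?_⟩
    · exact (eventually_atTop_succ.2 H).mono fun n hn =>
        (h.left.mem_elems hz closed_russell).1 hn
    · intro j hj H
      rw [hrun.mem_elems hz closed_russell] at H
      rcases j with _ | j
      · exact absurd H h2
      · rw [numeral_succ]
        exact h.left.eventually_eq_succ hy (closed_numeral j) (h3 j (by omega) H)

end IsLimitRun

/-! ### The McGee-style formulas -/

theorem mcGee_subst_mem {S : Set Fm} (hS : Full S) {c : Tm} (hc : c.Closed) :
    mcGee.subst 0 c ∈ S ↔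
      ((∃ w : Tm, w.Closed ∧ mem (opair w c) tOmega ∈ S) → mem russell c ∉ S) := by
  have hcf : c.fv = ∅ := hc
  have hfv : (mem (opair (.var 5) c) tOmega).fv ⊆ {5} := by
    simp [fv_opair, Expr.fv, hcf, show tOmega.fv = ∅ from closed_tOmega]
  have hex := hS.ex_mem hfv
  have hcl : (ex 5 (mem (opair (.var 5) c) tOmega)).Closed := by
    simpa [ex] using (closed_all (v := 5)).2 (by simpa using hfv)
  rw [← hS.neg_mem (by simp [hc]), mcGee]
  simp only [subst_imp, subst_ex c (show 5 ≠ 0 by decide), subst_mem, subst_neg,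
    subst_opair c (show 0 ≠ 6 by decide) (show 0 ≠ 7 by decide), subst_var_self,
    subst_var_of_ne c (show 5 ≠ 0 by decide), subst_of_closed closed_tOmega,
    subst_of_closed closed_russell]
  rw [hS.imp_mem hcl (by simp [hc]), hex]
  simp [subst_opair, subst_of_closed, hc]

/-- `∀ y (⟨x, y⟩ ∈ t_ω → r ∉ y*)`, where `x` is `v_0`, and `y*` is `y` delayed by seven stages: the
delay makes up for the stages that induction in `t_ω` loses. -/
def mcGeeNumeral : Fm :=
  .all 1 (imp (mem (opair (.var 0) (.var 1)) tOmega)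
    (neg (mem russell (elems^[7] (.var 1)))))

theorem fv_mcGeeNumeral : mcGeeNumeral.fv ⊆ {0} := by decide

theorem mcGeeNumeral_subst_mem {S : Set Fm} (hS : Full S) {c : Tm} (hc : c.Closed) :
    mcGeeNumeral.subst 0 c ∈ S ↔
      ∀ y : Tm, y.Closed → mem (opair c y) tOmega ∈ S → mem russell (elems^[7] y) ∉ S := by
  have hcl := closed_subst fv_mcGeeNumeral hc
  rw [mcGeeNumeral, subst_all c (by decide)] at hcl ⊢
  rw [hS.all_mem (closed_all.1 hcl)]
  refine forall₂_congr fun y hy => ?_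
  have hy7 := closed_elems_iterate hy 7
  have hmem := closed_mem.2 ⟨closed_russell, hy7⟩
  rw [← hS.neg_mem hmem, ← hS.imp_mem (by simp [closed_opair, hc, hy]) (closed_neg.2 hmem)]
  simp [subst_opair, subst_of_closed, subst_elems, subst_var_of_ne, hc]

namespace IsLimitRun

variable {σ τ : ℕ → Set Fm} (h : IsLimitRun σ τ)
include h

theorem eventually_mcGee {c : Tm} (hc : c.Closed) : ∀ᶠ n in atTop, mcGee.subst 0 c ∈ τ n := by
  by_contra H
  have hex : ∀ N, ∃ n ≥ N, ∃ w : Tm, w.Closed ∧ mem (opair w c) tOmega ∈ τ n ∧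
      mem russell c ∈ τ n := by
    simpa [mcGee_subst_mem (h.right.full _) hc] using frequently_atTop.1 (not_eventually.1 H)
  -- Two stages at which `r ∈ c`, and a third one from which induction in `t_ω` sees both.
  obtain ⟨m₁, h₁, -, -, -, hr₁⟩ := hex 1
  obtain ⟨m₂, h₂, -, -, -, hr₂⟩ := hex (m₁ + 1)
  obtain ⟨m₃, h₃, w, hw, hm₃, -⟩ := hex (m₂ + 7)
  obtain ⟨i, rfl⟩ := Nat.exists_eq_add_of_le' h₁
  obtain ⟨j, rfl⟩ := Nat.exists_eq_add_of_le' (show 1 ≤ m₂ by omega)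
  obtain ⟨p, rfl⟩ := Nat.exists_eq_add_of_le' (show 7 ≤ m₃ by omega)
  have := h.left.numeral_unique hw
    (h.eventually_eq_numeral_of_mem_tOmega hw hc hm₃ (by omega) hr₁)
    (h.eventually_eq_numeral_of_mem_tOmega hw hc hm₃ (by omega) hr₂)
  omega

theorem all_mcGee_notMem (n : ℕ) : Expr.all 0 mcGee ∉ τ (n + 1) := by
  rw [(h.right.full _).all_mem (by decide)]
  intro H
  have hc := closed_elems_iterate closed_tSet n
  exact (mcGee_subst_mem (h.right.full _) hc).1 (H _ hc)
    ⟨numeral n, closed_numeral n, h.right.opair_numeral_mem_tOmega n n⟩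
    (h.russell_mem_elems_iterate n)

theorem all_mcGeeNumeral_notMem (n : ℕ) :
    Expr.all 0 (imp (mem (.var 0) omega) mcGeeNumeral) ∉ τ (n + 8) := by
  have hS := h.right.full (n + 8)
  have hn := closed_numeral n
  have hc := closed_elems_iterate closed_tSet n
  rw [hS.all_mem (by decide)]
  intro H
  have H' := H _ hn
  rw [subst_imp, subst_mem, subst_var_self, subst_of_closed closed_omega,
    hS.imp_mem (by simp [hn]) (closed_subst fv_mcGeeNumeral hn),
    mcGeeNumeral_subst_mem hS hn] at H'
  exact H' (h.right.numeral_mem_omega _ n) _ hc (h.right.opair_numeral_mem_tOmega _ n)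
    ((h.right.mem_elems_iterate hc closed_russell 7).2 (h.russell_mem_elems_iterate n))

theorem eventually_mcGeeNumeral {c : Tm} (hc : c.Closed) :
    ∀ᶠ n in atTop, mcGeeNumeral.subst 0 c ∈ τ n := by
  by_contra H
  have hex : ∀ N, ∃ n ≥ N, ∃ y : Tm, y.Closed ∧ mem (opair c y) tOmega ∈ τ n ∧
      mem russell (elems^[7] y) ∈ τ n := by
    simpa [mcGeeNumeral_subst_mem (h.right.full _) hc] using
      frequently_atTop.1 (not_eventually.1 H)
  have key : ∀ N, ∃ i ≥ N, ∀ᶠ n in atTop, eq c (numeral i) ∈ σ n := by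
    intro N
    obtain ⟨m, hm, y, hy, hmem, hr⟩ := hex (N + 8)
    obtain ⟨i, rfl⟩ := Nat.exists_eq_add_of_le' (show 8 ≤ m by omega)
    rw [show i + 8 = i + 1 + 7 by omega] at hmem hr
    rw [h.right.mem_elems_iterate hy closed_russell] at hr
    exact ⟨i, by omega, h.eventually_eq_numeral_of_mem_tOmega hc hy hmem i.lt_succ_self hr⟩
  obtain ⟨i, -, hi⟩ := key 0
  obtain ⟨j, hj, hj'⟩ := key (i + 1)
  have := h.left.numeral_unique hc hi hj'
  omega

end IsLimitRun

/-! ### Barters and runs -/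

theorem stableBelow_succ {s : Ordinal.{0} → Set Fm} {α : Ordinal.{0}} {A : Fm} :
    StableBelow s (α + 1) A ↔ A ∈ s α := by
  constructor
  · rintro ⟨γ, hγ, H⟩
    exact H α (Order.lt_add_one_iff.1 hγ) (Order.lt_add_one_iff.2 le_rfl)
  · exact fun H => ⟨α, Order.lt_add_one_iff.2 le_rfl, fun δ h1 h2 =>
      (le_antisymm h1 (Order.lt_add_one_iff.1 h2)) ▸ H⟩

theorem exists_lt_add_nat {ν γ : Ordinal.{0}} (h : γ < ν + Ordinal.omega0) :
    ∃ n : ℕ, γ < ν + n := by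
  rcases lt_or_ge γ ν with hlt | hge
  · exact ⟨0, by simpa using hlt⟩
  · obtain ⟨n, hn⟩ := Ordinal.lt_omega0.1 (Ordinal.sub_lt_of_lt_add h Ordinal.omega0_pos)
    refine ⟨n + 1, ?_⟩
    rw [← Ordinal.add_sub_cancel_of_le hge, hn]
    gcongr
    simp

theorem stableBelow_add_omega0 {s : Ordinal.{0} → Set Fm} {ν : Ordinal.{0}} {A : Fm} :
    StableBelow s (ν + Ordinal.omega0) A ↔ ∀ᶠ n : ℕ in atTop, A ∈ s (ν + n) := by
  rw [eventually_atTop]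
  constructor
  · rintro ⟨γ, hγ, H⟩
    obtain ⟨N, hN⟩ := exists_lt_add_nat hγ
    refine ⟨N, fun n hn => H _ (hN.le.trans ?_) ?_⟩
    · gcongr
    · gcongr
      exact Ordinal.natCast_lt_omega0 n
  · rintro ⟨N, H⟩
    refine ⟨ν + N, by gcongr; exact Ordinal.natCast_lt_omega0 N, fun δ h1 h2 => ?_⟩
    have hν : ν ≤ δ := le_self_add.trans h1
    obtain ⟨n, hn⟩ := Ordinal.lt_omega0.1 (Ordinal.sub_lt_of_lt_add h2 Ordinal.omega0_pos)
    have hδ : δ = ν + n := by rw [← hn, Ordinal.add_sub_cancel_of_le hν]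
    rw [hδ] at h1 ⊢
    exact H n (by simpa using h1)

/-- The barters at `ν, ν + 1, ν + 2, …` on a given index. -/
def run {Ω : Type} (bar : Ω → Ordinal.{0} → Set Fm) (n : Ω) (ν : Ordinal.{0}) (k : ℕ) : Set Fm :=
  bar n (ν + k)

namespace IsBarter

variable {Ω : Type} {CD : Set (Set Fm)} {bar : Ω → Ordinal.{0} → Set Fm} (h : IsBarter CD bar)
include h

theorem tr_mem_succ (n : Ω) (α : Ordinal.{0}) {A : Fm} (hA : A.Closed) :
    tr A ∈ bar n (α + 1) ↔ A ∈ bar n α := by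
  rw [h.truth n _ (by simp) A hA, stableBelow_succ]

theorem isRun (n : Ω) (ν : Ordinal.{0}) : IsRun (run bar n ν) where
  full k := h.full n _
  truth k A hA := by
    rw [run, Nat.cast_succ, ← add_assoc, h.tr_mem_succ n _ hA, run]
  sets k v A a hA ha := by
    rw [run, Nat.cast_succ, ← add_assoc, h.sets n _ (by simp) v A a hA ha, stableBelow_succ, run]

theorem isLimitRun (n : Ω) (ν : Ordinal.{0}) :
    IsLimitRun (run bar n ν) (run bar n (ν + Ordinal.omega0)) where
  left := h.isRun n ν
  right := h.isRun n _
  truth A hA := by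
    have hpos : 0 < ν + Ordinal.omega0 := Ordinal.omega0_pos.trans_le le_add_self
    rw [run, Nat.cast_zero, add_zero, h.truth n _ hpos A hA, stableBelow_add_omega0]; rfl
  sets v A a hA ha := by
    have hpos : 0 < ν + Ordinal.omega0 := Ordinal.omega0_pos.trans_le le_add_self
    rw [run, Nat.cast_zero, add_zero, h.sets n _ hpos v A a hA ha, stableBelow_add_omega0]; rfl

theorem tr_mem_add_omega0_add_omega0 (n : Ω) (ν : Ordinal.{0}) {A : Fm} (hA : A.Closed) :
    tr A ∈ bar n (ν + Ordinal.omega0 + Ordinal.omega0) ↔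
      ∀ᶠ k in atTop, A ∈ run bar n (ν + Ordinal.omega0) k := by
  have := (h.isLimitRun n (ν + Ordinal.omega0)).truth A hA
  rwa [run, Nat.cast_zero, add_zero] at this

/-! ### The Barcan schema at successors and limits -/

theorem all_tr_mem (n : Ω) (α : Ordinal.{0}) {A : Fm} (hA : A.fv ⊆ {0}) :
    Expr.all 0 (tr A) ∈ bar n α ↔ ∀ c : Tm, c.Closed → tr (A.subst 0 c) ∈ bar n α :=
  (h.full n α).all_mem (by rwa [fv_tr])

theorem all_tr_mcGee_mem (n : Ω) (ν : Ordinal.{0}) :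
    Expr.all 0 (tr mcGee) ∈ bar n (ν + Ordinal.omega0 + Ordinal.omega0) := by
  rw [h.all_tr_mem n _ (by decide)]
  intro c hc
  rw [h.tr_mem_add_omega0_add_omega0 n ν (closed_subst (by decide) hc)]
  exact (h.isLimitRun n ν).eventually_mcGee hc

theorem tr_all_mcGee_notMem (n : Ω) (ν : Ordinal.{0}) :
    tr (.all 0 mcGee) ∉ bar n (ν + Ordinal.omega0 + Ordinal.omega0) := by
  rw [h.tr_mem_add_omega0_add_omega0 n ν (closed_all.2 (by decide))]
  intro H
  obtain ⟨k, hk⟩ := (eventually_atTop_succ.2 H).exists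
  exact (h.isLimitRun n ν).all_mcGee_notMem k hk

/-- At a successor, `𝒯` reports what holds one stage before, where `∀ x A` is the conjunction of its
instances. -/
theorem barcan_mem_succ (n : Ω) (α : Ordinal.{0}) {A : Fm} (hA : A.fv ⊆ {0}) :
    barcan 0 A ∈ bar n (α + 1) := by
  have hall : (Expr.all 0 A).Closed := closed_all.2 hA
  rw [barcan, (h.full n _).imp_mem (closed_all.2 (by rwa [fv_tr])) (by simpa using hall),
    h.all_tr_mem n _ hA, h.tr_mem_succ n _ hall, (h.full n _).all_mem hA]
  exact fun H c hc => (h.tr_mem_succ n _ (closed_subst hA hc)).1 (H c hc)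

theorem barcan_mcGee_notMem (n : Ω) (ν : Ordinal.{0}) :
    barcan 0 mcGee ∉ bar n (ν + Ordinal.omega0 + Ordinal.omega0) := by
  rw [barcan, (h.full n _).imp_mem (closed_all.2 (by decide))
    (closed_tr.2 (closed_all.2 (by decide)))]
  exact fun H => h.tr_all_mcGee_notMem n ν (H (h.all_tr_mcGee_mem n ν))

theorem mcGeeSchema_notMem (n : Ω) (ν : Ordinal.{0}) :
    mcGeeSchema mcGeeNumeral ∉ bar n (ν + Ordinal.omega0 + Ordinal.omega0) := by
  have h1 : (imp (mem (.var 0) omega) (tr mcGeeNumeral)).fv ⊆ {0} := by decide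
  have h2 : (imp (mem (.var 0) omega) mcGeeNumeral).fv ⊆ {0} := by decide
  rw [mcGeeSchema, (h.full n _).imp_mem (closed_all.2 h1) (closed_tr.2 (closed_all.2 h2)),
    (h.full n _).all_mem h1, h.tr_mem_add_omega0_add_omega0 n ν (closed_all.2 h2)]
  intro H
  have H' := H fun c hc => by
    have hcl := closed_subst fv_mcGeeNumeral hc
    rw [subst_imp, (h.full n _).imp_mem (by simp [hc, subst_of_closed])
      (by simpa using hcl)]
    rw [subst_tr, h.tr_mem_add_omega0_add_omega0 n ν hcl]
    exact fun _ => (h.isLimitRun n ν).eventually_mcGeeNumeral hc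
  rw [← map_add_atTop_eq_nat 8] at H'
  obtain ⟨k, hk⟩ := (eventually_map.1 H').exists
  exact (h.isLimitRun n ν).all_mcGeeNumeral_notMem k hk

/-! ### The closure ordinal -/

theorem tr_mem_of_forall_mem {n : Ω} {γ β : Ordinal.{0}} (hγ : γ < β) {A : Fm} (hA : A.Closed)
    (H : ∀ δ, γ ≤ δ → A ∈ bar n δ) : tr A ∈ bar n β :=
  (h.truth n β (pos_of_gt hγ) A hA).2 ⟨γ, hγ, fun δ hδ _ => H δ hδ⟩

theorem eventually_holdsAt_of_in {A : Fm} (hA : A.Closed) (H : In bar A) :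
    ∃ α, ∀ β, α ≤ β → HoldsAt bar β A := by
  obtain ⟨α, hα⟩ := H
  exact ⟨α, fun β hβ n => (h.tr_mem_succ n β hA).1
    (hα (β + 1) (hβ.trans (Order.le_succ β)) n)⟩

/-- Since the indices form a set, a sentence that is not `IN` fails cofinally on a single index. -/
theorem exists_cofinal_notMem {A : Fm} (hA : A.Closed) (H : ¬ In bar A) :
    ∃ n, ∀ γ, ∃ δ, γ ≤ δ ∧ A ∉ bar n δ := by
  by_contra! hcon
  choose γ hγ using hcon
  refine H ⟨(⨆ n, γ n) + 1, fun β hβ n => ?_⟩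
  exact h.tr_mem_of_forall_mem ((Ordinal.le_iSup γ n).trans_lt (Order.add_one_le_iff.1 hβ)) hA
    (hγ n)

/-- The closure ordinal is the least member of a nonempty class, so that its definition by an
infimum has no junk value. -/
theorem exists_stabilizes : ∃ α, ∀ A : Fm, A.Closed → Stabilizes bar α A := by
  have hc : ∀ A : Fm, ∃ α, In bar A → InFrom bar α A := fun A => by
    by_cases H : In bar A
    · exact H.imp fun α hα _ => hα
    · exact ⟨0, fun H' => absurd H' H⟩
  choose c hc using hc
  have hw : ∀ (A : Fm), ∃ w : Ordinal.{0} → Ordinal.{0}, A.Closed → ¬ In bar A →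
      ∃ n, ∀ γ, γ ≤ w γ ∧ A ∉ bar n (w γ) := fun A => by
    by_cases H : A.Closed ∧ ¬ In bar A
    · obtain ⟨n, hn⟩ := h.exists_cofinal_notMem H.1 H.2
      choose w hw using hn
      exact ⟨w, fun _ _ => ⟨n, hw⟩⟩
    · exact ⟨id, fun h1 h2 => absurd ⟨h1, h2⟩ H⟩
  choose w hw using hw
  -- Above all covering ordinals, close off under the witnesses of failure.
  let g : Ordinal.{0} → Ordinal.{0} := fun γ => ⨆ A, (w A γ + 1)
  have hg : ∀ A γ, w A γ < g γ := fun A γ =>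
    Order.add_one_le_iff.1 (Ordinal.le_iSup (fun A => w A γ + 1) A)
  refine ⟨Ordinal.nfp g (⨆ A, c A), fun A hA => ⟨fun hin β hβ => ?_, fun hhold => ?_⟩⟩
  · exact hc A hin β (((Ordinal.le_iSup c A).trans (Ordinal.le_nfp g _)).trans hβ)
  · by_contra hnin
    obtain ⟨n, hn⟩ := hw A hA hnin
    have hlt : ∀ k, w A (g^[k] (⨆ A, c A)) < Ordinal.nfp g (⨆ A, c A) := fun k => by
      refine (hg A _).trans_le ?_
      rw [← Function.iterate_succ_apply' g]
      exact Ordinal.iterate_le_nfp g _ _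
    obtain ⟨γ, hγ, H⟩ := (h.truth n _ (pos_of_gt (hlt 0)) A hA).1 (hhold n)
    obtain ⟨k, hk⟩ := Ordinal.lt_nfp_iff.1 hγ
    exact (hn _).2 (H _ (hk.le.trans (hn _).1) (hlt k))

theorem stabilizes_closureOrdinal {A : Fm} (hA : A.Closed) :
    Stabilizes bar (closureOrdinal bar) A :=
  csInf_mem (s := {α | ∀ A : Fm, A.Closed → Stabilizes bar α A}) h.exists_stabilizes A hA

theorem in_of_maxim {A : Fm} (hA : A.Closed) (H : Maxim bar A) : In bar A :=
  (h.stabilizes_closureOrdinal hA).2 H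

theorem eventually_holdsAt_of_maxim {A : Fm} (hA : A.Closed) (H : Maxim bar A) :
    ∃ α, ∀ β, α ≤ β → HoldsAt bar β A :=
  h.eventually_holdsAt_of_in hA (h.in_of_maxim hA H)

theorem holdsAt_closureOrdinal_of_maxim {A : Fm} (hA : A.Closed) (H : Maxim bar A) :
    HoldsAt bar (closureOrdinal bar) A := fun n =>
  (h.tr_mem_succ n _ hA).1
    ((h.stabilizes_closureOrdinal hA).1 (h.in_of_maxim hA H) _ (Order.le_succ _) n)

/-- An index whose initial set has no atomic members shows that no finite ordinal covers the
iterated truth ascriptions to a logical truth. -/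
theorem omega0_le_closureOrdinal (hempty : ∃ S ∈ CD, ∀ a b : Tm, mem a b ∉ S) :
    Ordinal.omega0 ≤ closureOrdinal bar := by
  by_contra! hlt
  obtain ⟨k, hk⟩ := Ordinal.lt_omega0.1 hlt
  obtain ⟨S, hS, hatom⟩ := hempty
  rw [← h.initial] at hS
  obtain ⟨n, rfl⟩ := hS
  have hcl : ∀ j, (tr^[j] (eq empty empty)).Closed := fun j => by
    induction j with
    | zero => exact closed_eq closed_empty closed_empty
    | succ j ih => rw [Function.iterate_succ_apply']; exact closed_tr.2 ih
  have hholds : ∀ (j : ℕ) (m : Ω) (β : Ordinal.{0}), (j : Ordinal.{0}) ≤ β →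
      tr^[j] (eq empty empty) ∈ bar m β := fun j m => by
    induction j with
    | zero => exact fun β _ => (h.full m β).eq_refl closed_empty
    | succ j ih =>
      intro β hβ
      rw [Function.iterate_succ_apply']
      exact h.tr_mem_of_forall_mem (γ := j) ((Nat.cast_lt.2 j.lt_succ_self).trans_le hβ) (hcl j) ih
  have hin : In bar (tr^[k] (eq empty empty)) := ⟨(k + 1 : ℕ), fun β hβ m => by
    rw [← Function.iterate_succ_apply' tr]
    exact hholds (k + 1) m β hβ⟩
  have hmem := (h.stabilizes_closureOrdinal (hcl k)).1 hin _ le_rfl n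
  have hnot : ∀ j : ℕ, tr (tr^[j] (eq empty empty)) ∉ bar n j := fun j => by
    induction j with
    | zero => rw [Nat.cast_zero]; exact hatom _ _
    | succ j ih =>
      rwa [Nat.cast_succ, h.tr_mem_succ n j (hcl (j + 1)), Function.iterate_succ_apply' tr]
  rw [hk] at hmem
  exact hnot k hmem

theorem russell_mem_succ (n : Ω) (α : Ordinal.{0}) :
    mem russell russell ∈ bar n (α + 1) ↔ mem russell russell ∉ bar n α := by
  have := (h.isRun n α).mem_russell (n := 0)
  simpa [run] using this

/-- From `ω` onwards all barters agree on whether `r ∈ r`. -/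
theorem russell_uniform (α : Ordinal.{0}) (hα : Ordinal.omega0 ≤ α) :
    HoldsAt bar α (mem russell russell) ∨ HoldsAt bar α (neg (mem russell russell)) := by
  have hneg : ∀ n δ, neg (mem russell russell) ∈ bar n δ ↔ mem russell russell ∉ bar n δ :=
    fun n δ => (h.full n δ).neg_mem (by simp)
  induction α using Ordinal.limitRecOn with
  | zero => exact absurd hα (not_le.2 Ordinal.omega0_pos)
  | add_one α ih =>
    have hα' : Ordinal.omega0 ≤ α := by
      by_contra! hlt
      exact absurd hα (not_le.2 (Ordinal.isSuccLimit_omega0.succ_lt hlt))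
    rcases ih hα' with H | H
    · exact .inr fun n => (hneg n _).2 fun H' => (h.russell_mem_succ n α).1 H' (H n)
    · exact .inl fun n => (h.russell_mem_succ n α).2 ((hneg n α).1 (H n))
  | limit α hlim ih =>
    refine .inr fun n => (hneg n α).2 fun H => ?_
    have hpos := Ordinal.omega0_pos.trans_le hα
    obtain ⟨γ, hγ, hst⟩ := (h.sets n α hpos _ _ _ closed_russell closed_russell).1 H
    have h1 : neg (mem russell russell) ∈ bar n γ := hst γ le_rfl hγ
    have h2 : neg (mem russell russell) ∈ bar n (γ + 1) :=
      hst (γ + 1) (Order.le_succ γ) (hlim.succ_lt hγ)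
    rw [hneg] at h1 h2
    exact h2 ((h.russell_mem_succ n γ).2 h1)

theorem closureOrdinal_ne_add_one (hempty : ∃ S ∈ CD, ∀ a b : Tm, mem a b ∉ S)
    (n : Ω) (β : Ordinal.{0}) : closureOrdinal bar ≠ β + 1 := by
  intro hβ
  have hω : Ordinal.omega0 ≤ β := by
    by_contra! hlt
    exact absurd ((h.omega0_le_closureOrdinal hempty).trans_eq hβ)
      (not_le.2 (Ordinal.isSuccLimit_omega0.succ_lt hlt))
  -- What holds in all barters at `β` is a maxim.
  have key : ∀ A : Fm, A.Closed → HoldsAt bar β A → ∃ α, ∀ δ, α ≤ δ → HoldsAt bar δ A :=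
    fun A hA H => h.eventually_holdsAt_of_maxim hA fun m => by
      rw [hβ]; exact (h.tr_mem_succ m β hA).2 (H m)
  rcases h.russell_uniform β hω with H | H
  · obtain ⟨α, hα⟩ := key _ (by simp) H
    exact (h.russell_mem_succ n α).1 (hα _ (Order.le_succ α) n) (hα α le_rfl n)
  · obtain ⟨α, hα⟩ := key _ (by simp) H
    have hneg : ∀ δ, α ≤ δ → mem russell russell ∉ bar n δ := fun δ hδ =>
      ((h.full n δ).neg_mem (by simp)).1 (hα δ hδ n)
    exact hneg _ (Order.le_succ α) ((h.russell_mem_succ n α).2 (hneg α le_rfl))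

/-- If `ϖ` were `ν + ω`, then `r ∉ t` would be a maxim. -/
theorem closureOrdinal_ne_add_omega0 (n : Ω) (ν : Ordinal.{0}) :
    closureOrdinal bar ≠ ν + Ordinal.omega0 := by
  intro hν
  have hcl : (neg (mem russell tSet)).Closed := by simp
  obtain ⟨α, hα⟩ := h.eventually_holdsAt_of_maxim hcl fun m => by
    have H := ((h.isLimitRun m ν).truth _ hcl).2 (eventually_atTop_succ.1 (eventually_atTop_succ.1
      (Eventually.of_forall fun k => (((h.isRun m ν).full _).neg_mem (by simp)).2
        ((h.isRun m ν).russell_notMem_tSet k))))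
    rw [hν]
    rwa [run, Nat.cast_zero, add_zero] at H
  refine ((h.full n _).neg_mem (by simp)).1 (hα (α + Ordinal.omega0 + (1 : ℕ)) ?_ n)
    (h.isLimitRun n α).russell_mem_tSet
  exact le_self_add.trans le_self_add

/-- The closure ordinal is a limit of limit ordinals. -/
theorem add_omega0_lt_closureOrdinal (hempty : ∃ S ∈ CD, ∀ a b : Tm, mem a b ∉ S) (n : Ω)
    {γ : Ordinal.{0}} (hγ : γ < closureOrdinal bar) :
    γ + Ordinal.omega0 < closureOrdinal bar := by
  have hfin : ∀ k : ℕ, γ + k < closureOrdinal bar := fun k => by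
    induction k with
    | zero => simpa using hγ
    | succ k ih =>
      rw [Nat.cast_succ, ← add_assoc]
      exact (Order.add_one_le_iff.2 ih).lt_of_ne (h.closureOrdinal_ne_add_one hempty n _).symm
  refine lt_of_le_of_ne ?_ (h.closureOrdinal_ne_add_omega0 n γ).symm
  by_contra! hlt
  obtain ⟨k, hk⟩ := exists_lt_add_nat hlt
  exact lt_asymm hk (hfin k)

/-- A sentence that holds cofinally below the closure ordinal in all barters is a thesis. -/
theorem thesis_of_cofinal (hpos : 0 < closureOrdinal bar) {A : Fm} (hA : A.Closed)
    (H : ∀ n, ∀ γ < closureOrdinal bar, ∃ δ, γ ≤ δ ∧ δ < closureOrdinal bar ∧ A ∈ bar n δ) :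
    Thesis bar A := by
  intro n
  have hneg : (neg A).Closed := by simpa
  rw [(h.full n _).neg_mem (by simpa), h.truth n _ hpos _ hneg]
  rintro ⟨γ, hγ, hst⟩
  obtain ⟨δ, h1, h2, h3⟩ := H n γ hγ
  exact ((h.full n δ).neg_mem hA).1 (hst δ h1 h2) h3

theorem not_maxim_of_forall_notMem (n : Ω) {A : Fm} (hA : A.Closed)
    (H : ∀ ν, A ∉ bar n (ν + Ordinal.omega0 + Ordinal.omega0)) : ¬ Maxim bar A := fun hM => by
  obtain ⟨α, hα⟩ := h.eventually_holdsAt_of_maxim hA hM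
  exact H α (hα _ (le_self_add.trans le_self_add) n)

end IsBarter

end Libra

open Libra in
theorem mainTheorem10 {Ω : Type} (CD : Set (Set Fm)) (hCD : ∀ S ∈ CD, Full S)
    (hempty : ∃ S ∈ CD, ∀ a b : Tm, mem a b ∉ S)
    (bar : Ω → Ordinal.{0} → Set Fm) (hbar : IsBarter CD bar) :
    -- the Barcan schema is not a maxim, as the instance for the McGee-style formula shows
    ¬ Maxim bar (barcan 0 mcGee) ∧
    -- this instance is a thesis, and so is its failure
    (Thesis bar (barcan 0 mcGee) ∧
      Thesis bar (conj (.all 0 (tr mcGee)) (neg (tr (.all 0 mcGee))))) ∧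
    -- an existential sentence holds in a barter just if some instance by a constant does
    (∀ n α (v : ℕ) (A : Fm), (ex v A).Closed →
      (ex v A ∈ bar n α ↔ ∃ b : Tm, b.Closed ∧ A.subst v b ∈ bar n α)) ∧
    -- the maxims are ω-consistent
    (¬ ∃ (v : ℕ) (A : Fm), (ex v A).Closed ∧ Maxim bar (ex v A) ∧
      ∀ b : Tm, b.Closed → Maxim bar (neg (A.subst v b))) ∧
    -- the schema on which McGee's argument relies is not a maxim
    (∃ A : Fm, A.fv ⊆ {0} ∧ ¬ Maxim bar (mcGeeSchema A)) := by
  obtain ⟨n₀⟩ : Nonempty Ω := by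
    obtain ⟨S, hS, -⟩ := hempty
    rw [← hbar.initial] at hS
    exact hS.nonempty
  have hpos : 0 < closureOrdinal bar :=
    Ordinal.omega0_pos.trans_le (hbar.omega0_le_closureOrdinal hempty)
  have hlim : ∀ γ, γ < closureOrdinal bar → γ + Ordinal.omega0 < closureOrdinal bar :=
    fun _ => hbar.add_omega0_lt_closureOrdinal hempty n₀
  have hall : (Expr.all 0 mcGee).Closed := closed_all.2 (by decide)
  have hallTr : (Expr.all 0 (tr mcGee)).Closed := closed_all.2 (by decide)
  have hbarcan : (barcan 0 mcGee).Closed := closed_imp.2 ⟨hallTr, closed_tr.2 hall⟩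
  have hneg : (neg (tr (.all 0 mcGee))).Closed := closed_neg.2 (closed_tr.2 hall)
  have hex : ∀ {v : ℕ} {A : Fm}, (ex v A).Closed → A.fv ⊆ {v} := fun hA =>
    fv_subset_of_erase ((fv_ex _ _).symm.trans hA)
  refine ⟨hbar.not_maxim_of_forall_notMem n₀ hbarcan (hbar.barcan_mcGee_notMem n₀),
    ⟨hbar.thesis_of_cofinal hpos hbarcan fun n γ hγ => ?_,
      hbar.thesis_of_cofinal hpos (closed_conj.2 ⟨hallTr, hneg⟩) fun n γ hγ => ?_⟩,
    fun n α v A hA => (hbar.full n α).ex_mem (hex hA), ?_,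
    mcGeeNumeral, fv_mcGeeNumeral,
    hbar.not_maxim_of_forall_notMem n₀ (show (mcGeeSchema _).fv = ∅ by decide)
      (hbar.mcGeeSchema_notMem n₀)⟩
  · refine ⟨γ + 1, Order.le_succ γ, lt_of_le_of_lt ?_ (hlim γ hγ),
      hbar.barcan_mem_succ n γ (by decide)⟩
    gcongr
    exact Ordinal.one_lt_omega0.le
  · refine ⟨γ + Ordinal.omega0 + Ordinal.omega0, le_self_add.trans le_self_add,
      hlim _ (hlim γ hγ), ?_⟩
    rw [(hbar.full n _).conj_mem hallTr hneg, (hbar.full n _).neg_mem (closed_tr.2 hall)]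
    exact ⟨hbar.all_tr_mcGee_mem n γ, hbar.tr_all_mcGee_notMem n γ⟩
  · rintro ⟨v, A, hA, hM, hinst⟩
    obtain ⟨b, hb, hbA⟩ := ((hbar.full n₀ _).ex_mem (hex hA)).1
      (hbar.holdsAt_closureOrdinal_of_maxim hA hM n₀)
    have hcl := closed_subst (hex hA) hb
    exact ((hbar.full n₀ _).neg_mem hcl).1
      (hbar.holdsAt_closureOrdinal_of_maxim (closed_neg.2 hcl) (hinst b hb) n₀) hbA
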